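/- Let $\mathcal G=(V,E)$ be a connected metric graph with finitely many vertices and finitely many edges (loops and multiple edges are allowed). Each edge is either bounded, identified with an interval $[0,\ell_e]$ with $\ell_e>0$, or a half-line, identified with $[0,+\infty)$ and attached to a vertex by its endpoint $0$. Assume that (H) every point of $\mathcal G$ lies on a trail (a connected path that runs through every edge at most once) that contains two half-lines, and that $\mathcal G$ has at least $3$ half-lines and at least one vertex of degree $2$ (the degree of a vertex is the number of edges emanating from it, loops counted twice). Let $2<p<6$ and $2<q<4$ with $q<\frac p2+1$. Let $H^1(\mathcal G)$ be the space of continuous real functions on $\mathcal G$ that are $H^1$ on each edge, and for $\mu>0$ let $H^1_\mu(\mathcal G):=\{u\in H^1(\mathcal G):\int_{\mathcal G}|u|^2\,dx=\mu\}$. A ground state of $$F_{p,q}(u,\mathcal G)=\frac12\int_{\mathcal G}|u'|^2\,dx-\frac1p\int_{\mathcal G}|u|^p\,dx-\frac1q\sum_{v\in V}|u(v)|^q$$ at mass $\mu$ is a function $u\in H^1_\mu(\mathcal G)$ with $F_{p,q}(u,\mathcal G)\le F_{p,q}(w,\mathcal G)$ for all $w\in H^1_\mu(\mathcal G)$. Then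 there exist $\underline{\mu}>0$ and $\widetilde{\mu}>0$, depending only on $p$, $q$ and $\mathcal G$, such that ground states of $F_{p,q}$ at mass $\mu$ exist for every $0<\mu<\underline{\mu}$ and for every $\mu\ge\widetilde{\mu}$. -/

import Mathlib

open MeasureTheory Set

noncomputable section

/-- A metric graph with set of vertices `V`, set of bounded edges `B` and set of half-lines `H`
(all of them finite in what follows). The bounded edge `e` is identified with the interval `[0, length e]`, the endpoint
`0` being glued to the vertex `src e` and the endpoint `length e` to the vertex `tgt e` (this is
only a choice of coordinates). The half-line `h` is identified with `[0, ∞)`, the endpoint `0` being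
glued to `base h`. Loops and multiple edges are allowed. -/
structure MetricGraph (V B H : Type*) where
  src : B → V
  tgt : B → V
  length : B → ℝ
  length_pos : ∀ e, 0 < length e
  base : H → V

/-- A real function on a metric graph, given edge by edge in the coordinates of the edges
(only the values on `[0, length e]`, respectively on `[0, ∞)`, matter), together with its
values at the vertices. -/
structure GraphFun (V B H : Type*) where
  onVertex : V → ℝ
  onEdge : B → ℝ → ℝ
  onHalf : H → ℝ → ℝ

namespace MetricGraph

variable {V B H : Type*}

/-- `G.IsWalk v w l`: the list `l` of bounded edges, each run through in one of its two directions,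
is a walk from `v` to `w`. -/
inductive IsWalk (G : MetricGraph V B H) : V → V → List B → Prop
  | nil (v : V) : IsWalk G v v []
  | forward (e : B) {w : V} {l : List B} :
      IsWalk G (G.tgt e) w l → IsWalk G (G.src e) w (e :: l)
  | backward (e : B) {w : V} {l : List B} :
      IsWalk G (G.src e) w l → IsWalk G (G.tgt e) w (e :: l)

/-- The graph is connected. -/
def Connected (G : MetricGraph V B H) : Prop :=
  Nonempty V ∧ ∀ v w : V, ∃ l : List B, G.IsWalk v w l

/-- The degree of a vertex: the number of edges emanating from it, a loop counting twice. -/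
def degree (G : MetricGraph V B H) (v : V) : ℕ :=
  {e | G.src e = v}.ncard + {e | G.tgt e = v}.ncard + {h | G.base h = v}.ncard

/-- The points of the graph: the vertices and the interior points of the edges. -/
inductive Point (G : MetricGraph V B H) : Type _
  | vertex (v : V) : Point G
  | onEdge (e : B) (x : Ioo (0 : ℝ) (G.length e)) : Point G
  | onHalf (h : H) (x : Ioi (0 : ℝ)) : Point G

/-- A trail containing two half-lines: it comes in along the half-line `first`, runs through the
list `mid` of bounded edges and leaves along the half-line `last`; no edge is run through twice.
(A half-line can only be the first or the last edge of a trail.) -/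
structure LineTrail (G : MetricGraph V B H) where
  first : H
  last : H
  mid : List B
  isWalk : G.IsWalk (G.base first) (G.base last) mid
  ne : first ≠ last
  nodup : mid.Nodup

/-- The point lies on the trail. -/
def LineTrail.Contains {G : MetricGraph V B H} (T : G.LineTrail) : G.Point → Prop
  | .vertex v => v = G.base T.first ∨ v = G.base T.last ∨
      ∃ e ∈ T.mid, v = G.src e ∨ v = G.tgt e
  | .onEdge e _ => e ∈ T.mid
  | .onHalf h _ => h = T.first ∨ h = T.last

/-- Assumption (H): every point of the graph lies on a trail that contains two half-lines. -/
def AssumptionH (G : MetricGraph V B H) : Prop :=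
  ∀ x : G.Point, ∃ T : G.LineTrail, T.Contains x

/-- The Sobolev space `H¹(G)`: functions that are continuous on the graph and of class `H¹` on
every edge, that is, (locally) absolutely continuous and square integrable there with square
integrable derivative. -/
structure MemH1 (G : MetricGraph V B H) (u : GraphFun V B H) : Prop where
  edge_src : ∀ e, u.onEdge e 0 = u.onVertex (G.src e)
  edge_tgt : ∀ e, u.onEdge e (G.length e) = u.onVertex (G.tgt e)
  half_base : ∀ h, u.onHalf h 0 = u.onVertex (G.base h)
  edge_ac : ∀ e, AbsolutelyContinuousOnInterval (u.onEdge e) 0 (G.length e)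
  edge_memLp : ∀ e, MemLp (u.onEdge e) 2 (volume.restrict (Ioo 0 (G.length e)))
  edge_deriv : ∀ e, MemLp (deriv (u.onEdge e)) 2 (volume.restrict (Ioo 0 (G.length e)))
  half_ac : ∀ h, ∀ R : ℝ, 0 < R → AbsolutelyContinuousOnInterval (u.onHalf h) 0 R
  half_memLp : ∀ h, MemLp (u.onHalf h) 2 (volume.restrict (Ioi 0))
  half_deriv : ∀ h, MemLp (deriv (u.onHalf h)) 2 (volume.restrict (Ioi 0))

variable [Fintype V] [Fintype B] [Fintype H]

/-- The integral over the graph of the function given by `f` on the bounded edges and by `g` on the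
half-lines. -/
def integral (G : MetricGraph V B H) (f : B → ℝ → ℝ) (g : H → ℝ → ℝ) : ℝ :=
  (∑ e, ∫ x in Ioo 0 (G.length e), f e x) + (∑ h, ∫ x in Ioi (0 : ℝ), g h x)

/-- The mass `∫ |u|²`. -/
def mass (G : MetricGraph V B H) (u : GraphFun V B H) : ℝ :=
  G.integral (fun e x => |u.onEdge e x| ^ 2) (fun h x => |u.onHalf h x| ^ 2)

/-- The energy `F_{p,q}(u, G) = 1/2 ∫ |u'|² - 1/p ∫ |u|^p - 1/q ∑_v |u(v)|^q`. -/
def energy (G : MetricGraph V B H) (p q : ℝ) (u : GraphFun V B H) : ℝ :=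
  1 / 2 * G.integral (fun e x => |deriv (u.onEdge e) x| ^ 2)
      (fun h x => |deriv (u.onHalf h) x| ^ 2)
    - 1 / p * G.integral (fun e x => |u.onEdge e x| ^ p) (fun h x => |u.onHalf h x| ^ p)
    - 1 / q * ∑ v, |u.onVertex v| ^ q

/-- `u` belongs to `H¹_μ(G)`, the functions in `H¹(G)` of mass `μ`. -/
def MemH1Mass (G : MetricGraph V B H) (μ : ℝ) (u : GraphFun V B H) : Prop :=
  G.MemH1 u ∧ G.mass u = μ

/-- `u` is a ground state of `F_{p,q}` at mass `μ`: a global minimizer of the energy on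
`H¹_μ(G)`. -/
def IsGroundState (G : MetricGraph V B H) (p q μ : ℝ) (u : GraphFun V B H) : Prop :=
  G.MemH1Mass μ u ∧ ∀ v, G.MemH1Mass μ v → G.energy p q u ≤ G.energy p q v

end MetricGraph

end

namespace MetricGraph
open Filter Topology

/-! ### Absolutely continuous functions -/

/-! The only obstruction to minimizing is the escape of mass along the half-lines, and escaping mass
does no better than a soliton on the real line, whose energy at mass `m` is `lineEnergy p m < 0`.
Hence the criterion `exists_isGroundState_of_lt`: a single function of mass at most `m` with energy
strictly below `lineEnergy p m` forces a ground state at mass `m`.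

For the criterion, coercivity (`exists_kinetic_le`, from `p < 6` and `q < 4`) bounds a minimizing
sequence. Along a subsequence it converges pointwise to some `u`, and `limit_energy_le` charges the
lost mass at the rate of the line: `E(u) + (m - mass u) / m * lineEnergy p m ≤ I`, where `I` is the
infimum. As `p, q > 2`, scaling gives `E(u) ≥ (mass u / m) * I`. Since `I < lineEnergy p m`, no mass
is lost. Assumption (H) makes every vertex an end of an edge, so that vertex values are controlled
by the edges.

The line bound needs no rearrangement. If `M` is the maximum of `|v|`, the first integral of the
soliton of height `M` and Young's inequality bound the energy below by an explicit function of `M`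
and the mass (`energy_interval_ge`), which is minimal at `solitonHeight`.

Competitors. For small `m`: a constant on the compact core with exponential tails has energy at most
`-C m ^ (q / (4 - q))`, against `-C' m ^ ((p + 2) / (6 - p))` for the line; the first exponent is
smaller exactly when `q < p / 2 + 1`. For large `m`: near a vertex of degree two the graph looks
like a line, so a soliton centred there and cut off at a fixed distance loses only an exponentially
small amount, less than the gain from the vertex term. -/

theorem ac_comp {Φ w : ℝ → ℝ} (hΦ : ∀ s, HasDerivAt Φ (w s) s) (hw : Continuous w)
    {v : ℝ → ℝ} {a b : ℝ} (hv : AbsolutelyContinuousOnInterval v a b) :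
    AbsolutelyContinuousOnInterval (fun x => Φ (v x)) a b := by
  obtain ⟨C, hC⟩ := hv.exists_bound
  have hcd : ContDiff ℝ 1 Φ := by
    rw [contDiff_one_iff_deriv]
    refine ⟨fun s => (hΦ s).differentiableAt, ?_⟩
    have : deriv Φ = w := funext fun s => (hΦ s).deriv
    rwa [this]
  -- `v` takes values in `[-C, C]`, where the `C¹` function `Φ` is Lipschitz.
  obtain ⟨K, hK⟩ := hcd.contDiffOn.exists_lipschitzOnWith (by decide) (convex_Icc (-C) C)
    isCompact_Icc
  have hmem : ∀ x ∈ uIcc a b, v x ∈ Icc (-C) C := fun x hx => by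
    have := hC x hx
    rw [Real.norm_eq_abs, abs_le] at this
    exact this
  have h0 := Tendsto.const_mul (K : ℝ) hv
  rw [mul_zero] at h0
  refine squeeze_zero' (Eventually.of_forall fun E => Finset.sum_nonneg fun i _ => dist_nonneg) ?_ h0
  have : ∀ᶠ E in AbsolutelyContinuousOnInterval.totalLengthFilter ⊓
      𝓟 (AbsolutelyContinuousOnInterval.disjWithin a b),
      E ∈ AbsolutelyContinuousOnInterval.disjWithin a b :=
    mem_inf_of_right (mem_principal_self _)
  filter_upwards [this] with E hE
  rw [Finset.mul_sum]
  refine Finset.sum_le_sum fun i hi => ?_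
  exact hK.dist_le_mul _ (hmem _ (hE.1 i hi).1) _ (hmem _ (hE.1 i hi).2)

theorem integral_comp_mul_deriv_of_ac {Φ w : ℝ → ℝ} (hΦ : ∀ s, HasDerivAt Φ (w s) s)
    (hw : Continuous w) {v : ℝ → ℝ} {a b : ℝ} (hv : AbsolutelyContinuousOnInterval v a b) :
    ∫ x in a..b, w (v x) * deriv v x = Φ (v b) - Φ (v a) := by
  rw [← (ac_comp hΦ hw hv).integral_deriv_eq_sub]
  refine intervalIntegral.integral_congr_ae ?_
  filter_upwards [hv.ae_differentiableAt] with x hx hmem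
  exact ((hΦ (v x)).comp x (hx (uIoc_subset_uIcc hmem)).hasDerivAt).deriv.symm

/-- Young's inequality applied to the chain rule (the Modica–Mortola trick), with equality when `v'
= w(v)` or `v' = -w(v)`. A linear `w` yields pointwise bounds; `w = solitonSlope` yields the sharp
energy bound. -/
theorem abs_comp_sub_le_of_ac {Φ w : ℝ → ℝ} (hΦ : ∀ s, HasDerivAt Φ (w s) s)
    (hw : Continuous w) {v : ℝ → ℝ} {a b : ℝ} (hab : a ≤ b)
    (hv : AbsolutelyContinuousOnInterval v a b)
    (hd : IntervalIntegrable (fun x => deriv v x ^ 2) volume a b) :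
    |Φ (v b) - Φ (v a)| ≤
      1 / 2 * (∫ x in a..b, deriv v x ^ 2) + 1 / 2 * ∫ x in a..b, w (v x) ^ 2 := by
  have hwc : ContinuousOn (fun x => w (v x)) (uIcc a b) := hw.comp_continuousOn hv.continuousOn
  have hwi : IntervalIntegrable (fun x => w (v x) ^ 2) volume a b :=
    (hwc.pow 2).intervalIntegrable
  have hpi : IntervalIntegrable (fun x => w (v x) * deriv v x) volume a b :=
    hv.intervalIntegrable_deriv.continuousOn_mul hwc
  rw [← integral_comp_mul_deriv_of_ac hΦ hw hv, ← intervalIntegral.integral_const_mul,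
    ← intervalIntegral.integral_const_mul, ← intervalIntegral.integral_add (hd.const_mul _)
      (hwi.const_mul _)]
  refine (intervalIntegral.abs_integral_le_integral_abs hab).trans ?_
  refine intervalIntegral.integral_mono_on hab hpi.abs ((hd.const_mul _).add (hwi.const_mul _)) ?_
  intro x _
  rw [abs_le]
  constructor <;> nlinarith [sq_nonneg (w (v x) + deriv v x), sq_nonneg (w (v x) - deriv v x)]

/-- The case `w(s) = t * s`. The free `t` is later tuned to balance mass against kinetic energy. -/
theorem abs_sq_sub_sq_le_of_ac {v : ℝ → ℝ} {a b : ℝ} (hab : a ≤ b)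
    (hv : AbsolutelyContinuousOnInterval v a b)
    (hd : IntervalIntegrable (fun x => deriv v x ^ 2) volume a b) {t : ℝ} (ht : 0 < t) :
    |v b ^ 2 - v a ^ 2| ≤ t * (∫ x in a..b, v x ^ 2) + t⁻¹ * ∫ x in a..b, deriv v x ^ 2 := by
  have h := abs_comp_sub_le_of_ac (Φ := fun s => t / 2 * s ^ 2) (w := fun s => t * s)
    (fun s => by
      have := (hasDerivAt_pow 2 s).const_mul (t / 2)
      convert! this using 1
      simp; ring) (by fun_prop) hab hv hd
  have e1 : ∫ x in a..b, (t * v x) ^ 2 = t ^ 2 * ∫ x in a..b, v x ^ 2 := by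
    rw [← intervalIntegral.integral_const_mul]
    congr 1; ext x; ring
  have e2 : t / 2 * v b ^ 2 - t / 2 * v a ^ 2 = t / 2 * (v b ^ 2 - v a ^ 2) := by ring
  simp only [e1] at h
  rw [e2, abs_mul, abs_of_pos (by positivity)] at h
  have := mul_le_mul_of_nonneg_left h (show 0 ≤ 2 / t by positivity)
  calc _ = 2 / t * (t / 2 * |v b ^ 2 - v a ^ 2|) := by field_simp
    _ ≤ _ := this
    _ = _ := by field_simp; ring

/-- Pointwise control of a function on an interval by its `H¹` data. -/
theorem sq_le_of_ac {v : ℝ → ℝ} {a b : ℝ} (hab : a < b)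
    (hv : AbsolutelyContinuousOnInterval v a b)
    (hd : IntervalIntegrable (fun x => deriv v x ^ 2) volume a b) {t : ℝ} (ht : 0 < t)
    {x : ℝ} (hx : x ∈ Icc a b) :
    v x ^ 2 ≤ ((b - a)⁻¹ + t) * (∫ y in a..b, v y ^ 2) + t⁻¹ * ∫ y in a..b, deriv v y ^ 2 := by
  have hvc : ContinuousOn (fun y => v y ^ 2) (uIcc a b) := hv.continuousOn.pow 2
  have hvi := hvc.intervalIntegrable (μ := volume)
  set A := ∫ y in a..b, v y ^ 2
  set D := ∫ y in a..b, deriv v y ^ 2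
  -- Averaging this bound over `y` replaces the unknown value at `y` by the mean of `v²`.
  have key : ∀ y ∈ Icc a b, v x ^ 2 - (t * A + t⁻¹ * D) ≤ v y ^ 2 := by
    have aux : ∀ y z, y ∈ Icc a b → z ∈ Icc a b → y ≤ z →
        |v z ^ 2 - v y ^ 2| ≤ t * A + t⁻¹ * D := by
      intro y z hy hz hyz
      have hsub : uIcc y z ⊆ uIcc a b := by
        rw [uIcc_of_le hyz, uIcc_of_le hab.le]; exact Icc_subset_Icc hy.1 hz.2
      refine (abs_sq_sub_sq_le_of_ac hyz (hv.mono hsub) (hd.mono_set hsub) ht).trans ?_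
      have i1 : ∫ x in y..z, v x ^ 2 ≤ A :=
        intervalIntegral.integral_mono_interval hy.1 hyz hz.2
          (Eventually.of_forall fun _ => sq_nonneg _) hvi
      have i2 : ∫ x in y..z, deriv v x ^ 2 ≤ D :=
        intervalIntegral.integral_mono_interval hy.1 hyz hz.2
          (Eventually.of_forall fun _ => sq_nonneg _) hd
      gcongr
    intro y hy
    rcases le_total x y with h | h
    · have := (abs_le.1 (aux x y hx hy h)).1; linarith
    · have := (abs_le.1 (aux y x hy hx h)).2; linarith
  have h1 : ∫ _y in a..b, (v x ^ 2 - (t * A + t⁻¹ * D)) ≤ A :=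
    intervalIntegral.integral_mono_on hab.le (by simp) hvi key
  rw [intervalIntegral.integral_const, smul_eq_mul] at h1
  have hba : 0 < b - a := sub_pos.2 hab
  have h2 : v x ^ 2 - (t * A + t⁻¹ * D) ≤ (b - a)⁻¹ * A := by
    rw [inv_mul_eq_div (b - a) A, le_div_iff₀ hba]; linarith
  linarith

/-! ### The soliton profile and the energy threshold of the line -/

/-- The slope `|φ'|` of the soliton of height `M` at the points where its value is `s`. -/
noncomputable def solitonSlope (p M s : ℝ) : ℝ :=
  |s| * √(2 / p * (M ^ (p - 2) - |s| ^ (p - 2)))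

/-- The primitive of `solitonSlope`. -/
noncomputable def slopePrimitive (p M s : ℝ) : ℝ := ∫ r in (0 : ℝ)..s, solitonSlope p M r

/-- Half the action of the soliton of height `1`. -/
noncomputable def lineConst (p : ℝ) : ℝ := slopePrimitive p 1 1

theorem solitonSlope_nonneg (p M s : ℝ) : 0 ≤ solitonSlope p M s := by
  unfold solitonSlope; positivity

/-- `Real.sqrt` is zero at negative arguments, so for `M ≥ 0` the slope is zero when `|s| > M`. It
therefore has a primitive on all of `ℝ`. -/
theorem continuous_solitonSlope {p : ℝ} (hp : 2 < p) (M : ℝ) : Continuous (solitonSlope p M) := by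
  unfold solitonSlope
  have : Continuous fun s : ℝ => |s| ^ (p - 2) :=
    continuous_abs.rpow_const fun _ => Or.inr (by linarith)
  fun_prop

theorem hasDerivAt_slopePrimitive {p : ℝ} (hp : 2 < p) (M s : ℝ) :
    HasDerivAt (slopePrimitive p M) (solitonSlope p M s) s :=
  (continuous_solitonSlope hp M).integral_hasStrictDerivAt 0 s |>.hasDerivAt

theorem slopePrimitive_nonneg (p M : ℝ) {s : ℝ} (hs : 0 ≤ s) : 0 ≤ slopePrimitive p M s :=
  intervalIntegral.integral_nonneg hs fun _ _ => solitonSlope_nonneg _ _ _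

theorem slopePrimitive_neg (p M s : ℝ) : slopePrimitive p M (-s) = -slopePrimitive p M s := by
  unfold slopePrimitive
  have := intervalIntegral.integral_comp_neg (a := 0) (b := s) (solitonSlope p M)
  have h2 : (fun x => solitonSlope p M (-x)) = solitonSlope p M := by
    ext x; simp [solitonSlope]
  simp only [h2, neg_zero] at this
  rw [this, intervalIntegral.integral_symm]

/-- The slope is even and its primitive odd, which frees the energy bound from sign assumptions on
`v`. -/
theorem abs_slopePrimitive (p M s : ℝ) : |slopePrimitive p M s| = slopePrimitive p M |s| := by
  rcases le_total 0 s with h | h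
  · rw [abs_of_nonneg h, abs_of_nonneg (slopePrimitive_nonneg p M h)]
  · rw [abs_of_nonpos h, slopePrimitive_neg, ← abs_neg, ← slopePrimitive_neg,
      abs_of_nonneg (slopePrimitive_nonneg p M (by linarith))]

/-- The first integral of the soliton equation, normalized to vanish at height `M`. It converts the
Young term into mass and potential energy. -/
theorem solitonSlope_sq {p M s : ℝ} (hp : 2 < p) (hs : |s| ≤ M) :
    solitonSlope p M s ^ 2 = 2 / p * (M ^ (p - 2) * s ^ 2 - |s| ^ p) := by
  have h1 : |s| ^ (p - 2) ≤ M ^ (p - 2) :=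
    Real.rpow_le_rpow (abs_nonneg _) hs (by linarith)
  have h3 : |s| ^ p = s ^ 2 * |s| ^ (p - 2) := by
    rcases eq_or_ne s 0 with rfl | h
    · simp [Real.zero_rpow (show p ≠ 0 by linarith)]
    · rw [← sq_abs, ← Real.rpow_natCast, ← Real.rpow_add (abs_pos.2 h)]
      congr 1; push_cast; ring
  unfold solitonSlope
  rw [mul_pow, Real.sq_sqrt (mul_nonneg (by positivity) (by linarith)), sq_abs, h3]
  ring

/-- Dropping the negative term under the root gives a bound quadratic in `s`, so boundary terms
disappear when boundary values tend to zero. -/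
theorem slopePrimitive_le {p M s : ℝ} (hp : 2 < p) (hs : 0 ≤ s) :
    slopePrimitive p M s ≤ √(2 / p * M ^ (p - 2)) * (s ^ 2 / 2) := by
  have h : slopePrimitive p M s ≤ ∫ r in (0 : ℝ)..s, r * √(2 / p * M ^ (p - 2)) := by
    refine intervalIntegral.integral_mono_on hs
      ((continuous_solitonSlope hp M).intervalIntegrable _ _)
      (Continuous.intervalIntegrable (by fun_prop) _ _) fun r hr => ?_
    unfold solitonSlope
    rw [abs_of_nonneg hr.1]
    refine mul_le_mul_of_nonneg_left (Real.sqrt_le_sqrt ?_) hr.1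
    have := Real.rpow_nonneg hr.1 (p - 2)
    exact mul_le_mul_of_nonneg_left (by linarith) (by positivity)
  rw [intervalIntegral.integral_mul_const, integral_id] at h
  linarith

/-- The ratio `solitonSlope p M r / r` is nonincreasing for `r > 0`; integrate `r` times its value
at `s`. -/
theorem mul_solitonSlope_le {p M s : ℝ} (hp : 2 < p) (hs : 0 ≤ s) :
    s * solitonSlope p M s ≤ 2 * slopePrimitive p M s := by
  have h : ∫ r in (0 : ℝ)..s, r * √(2 / p * (M ^ (p - 2) - |s| ^ (p - 2))) ≤
      slopePrimitive p M s := by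
    refine intervalIntegral.integral_mono_on hs
      (Continuous.intervalIntegrable (by fun_prop) _ _)
      ((continuous_solitonSlope hp M).intervalIntegrable _ _) fun r hr => ?_
    unfold solitonSlope
    rw [abs_of_nonneg hr.1, abs_of_nonneg hs]
    refine mul_le_mul_of_nonneg_left (Real.sqrt_le_sqrt ?_) hr.1
    have := Real.rpow_le_rpow hr.1 hr.2 (show 0 ≤ p - 2 by linarith)
    exact mul_le_mul_of_nonneg_left (by linarith) (by positivity)
  rw [intervalIntegral.integral_mul_const, integral_id] at h
  unfold solitonSlope
  rw [abs_of_nonneg hs] at *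
  nlinarith

theorem lineConst_pos {p : ℝ} (hp : 2 < p) : 0 < lineConst p := by
  refine intervalIntegral.intervalIntegral_pos_of_pos_on
    ((continuous_solitonSlope hp 1).intervalIntegrable _ _) (fun r hr => ?_) one_pos
  unfold solitonSlope
  have : r ^ (p - 2) < 1 := Real.rpow_lt_one hr.1.le hr.2 (by linarith)
  rw [abs_of_pos hr.1, Real.one_rpow]
  have h1 : 0 < 1 - r ^ (p - 2) := by linarith
  have := hr.1
  positivity

/-- Substituting `r ↦ M * r` gives `M` from the differential, `M` from `|s|` and `M ^ ((p - 2) / 2)`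
from the root. -/
theorem slopePrimitive_self {p M : ℝ} (hM : 0 < M) :
    slopePrimitive p M M = lineConst p * M ^ ((p + 2) / 2) := by
  have h := intervalIntegral.smul_integral_comp_mul_left (a := 0) (b := 1) (solitonSlope p M) M
  rw [mul_zero, mul_one] at h
  unfold lineConst slopePrimitive
  rw [← h, smul_eq_mul, mul_comm (∫ _ in _.._, _), ← intervalIntegral.integral_const_mul,
    ← intervalIntegral.integral_const_mul]
  refine intervalIntegral.integral_congr fun r hr => ?_
  rw [uIcc_of_le zero_le_one] at hr
  have e : 2 / p * (M ^ (p - 2) - (M * r) ^ (p - 2)) =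
      M ^ (p - 2) * (2 / p * (1 - r ^ (p - 2))) := by
    rw [Real.mul_rpow hM.le hr.1]; ring
  have e2 : M ^ ((p + 2) / 2) = M * (M * √(M ^ (p - 2))) := by
    have h1 : M * M = M ^ (2 : ℝ) := by rw [Real.rpow_two]; ring
    rw [Real.sqrt_eq_rpow, ← Real.rpow_mul hM.le, ← mul_assoc, h1, ← Real.rpow_add hM]
    congr 1; ring
  simp only [solitonSlope]
  rw [abs_of_nonneg (mul_nonneg hM.le hr.1), abs_of_nonneg hr.1, e, Real.one_rpow,
    Real.sqrt_mul (Real.rpow_nonneg hM.le _), e2]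
  ring

/-- The height of the soliton of mass `m` on the line. -/
noncomputable def solitonHeight (p m : ℝ) : ℝ :=
  ((p - 2) * m / (p * lineConst p * (p + 2))) ^ (2 / (6 - p))

/-- The energy of the soliton of mass `m` on the line. -/
noncomputable def lineEnergy (p m : ℝ) : ℝ :=
  2 * lineConst p * solitonHeight p m ^ ((p + 2) / 2) - solitonHeight p m ^ (p - 2) * m / p

theorem solitonHeight_pos {p m : ℝ} (hp : 2 < p) (hm : 0 < m) : 0 < solitonHeight p m := by
  have := lineConst_pos hp
  have : 0 < p - 2 := by linarith
  unfold solitonHeight; positivity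

/-- The critical point equation, multiplied by `M`, of `M ↦ 2 * lineConst p * M ^ ((p + 2) / 2) - M
^ (p - 2) * m / p`. -/
theorem solitonHeight_spec {p m : ℝ} (hp : 2 < p) (hp' : p < 6) (hm : 0 < m) :
    (p + 2) * (lineConst p * solitonHeight p m ^ ((p + 2) / 2)) =
      (p - 2) * (solitonHeight p m ^ (p - 2) * m / p) := by
  have hJ := lineConst_pos hp
  have h2 : 0 < p - 2 := by linarith
  have h6 : 0 < 6 - p := by linarith
  have hM := solitonHeight_pos hp hm
  have h1 : solitonHeight p m ^ ((6 - p) / 2) = (p - 2) * m / (p * lineConst p * (p + 2)) := by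
    unfold solitonHeight
    rw [← Real.rpow_mul (by positivity), show 2 / (6 - p) * ((6 - p) / 2) = 1 by field_simp,
      Real.rpow_one]
  have h3 : solitonHeight p m ^ ((p + 2) / 2) =
      solitonHeight p m ^ ((6 - p) / 2) * solitonHeight p m ^ (p - 2) := by
    rw [← Real.rpow_add hM]; congr 1; ring
  rw [h3, h1]
  field_simp

theorem lineEnergy_eq {p m : ℝ} (hp : 2 < p) (hp' : p < 6) (hm : 0 < m) :
    lineEnergy p m =
      -((6 - p) / (p - 2) * lineConst p * solitonHeight p m ^ ((p + 2) / 2)) := by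
  have h := solitonHeight_spec hp hp' hm
  have h2 : 0 < p - 2 := by linarith
  have h3 : solitonHeight p m ^ (p - 2) * m / p =
      (p + 2) * (lineConst p * solitonHeight p m ^ ((p + 2) / 2)) / (p - 2) := by
    rw [h]; field_simp
  unfold lineEnergy
  rw [h3]; field_simp; ring

theorem lineEnergy_neg {p m : ℝ} (hp : 2 < p) (hp' : p < 6) (hm : 0 < m) :
    lineEnergy p m < 0 := by
  rw [lineEnergy_eq hp hp' hm]
  have := lineConst_pos hp
  have := solitonHeight_pos hp hm
  have h2 : 0 < p - 2 := by linarith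
  have h6 : 0 < 6 - p := by linarith
  rw [neg_lt_zero]; positivity

/-- The soliton height minimizes the right-hand side. In the variable `x = (M / N) ^ α`, that side
is linear minus a multiple of `x ^ r`, with `r ≤ 1` because `p < 6`; Bernoulli's inequality is the
tangent line at `x = 1`. -/
theorem lineEnergy_le {p m : ℝ} (hp : 2 < p) (hp' : p < 6) (hm : 0 < m) {M : ℝ} (hM : 0 ≤ M) :
    lineEnergy p m ≤ 2 * lineConst p * M ^ ((p + 2) / 2) - M ^ (p - 2) * m / p := by
  set N := solitonHeight p m with hN
  have hN0 : 0 < N := solitonHeight_pos hp hm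
  have hspec := solitonHeight_spec hp hp' hm
  rw [← hN] at hspec
  set α := (p + 2) / 2 with hα
  set r := (p - 2) / α with hr
  have hα0 : 0 < α := by positivity
  have h2 : 0 < p - 2 := by linarith
  have hr0 : 0 ≤ r := by positivity
  have hr1 : r ≤ 1 := by rw [hr, div_le_one hα0]; rw [hα]; linarith
  set x := (M / N) ^ α with hx
  have hx0 : 0 ≤ x := by positivity
  have hb := rpow_one_add_le_one_add_mul_self (s := x - 1) (by linarith) hr0 hr1
  rw [show 1 + (x - 1) = x by ring] at hb
  have hxr : x ^ r * N ^ (p - 2) = M ^ (p - 2) := by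
    rw [hx, ← Real.rpow_mul (by positivity), hr, mul_div_cancel₀ _ hα0.ne',
      Real.div_rpow hM hN0.le, div_mul_cancel₀]
    positivity
  have hxα : x * N ^ α = M ^ α := by
    rw [hx, Real.div_rpow hM hN0.le, div_mul_cancel₀]
    positivity
  have hk : 0 ≤ N ^ (p - 2) * m / p := by positivity
  have h5 : r * (N ^ (p - 2) * m / p) = 2 * lineConst p * N ^ α := by
    have : r * (N ^ (p - 2) * m / p) = (p - 2) * (N ^ (p - 2) * m / p) / α := by
      rw [hr]; ring
    rw [this, ← hspec, hα]; field_simp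
  have h6 : M ^ (p - 2) * m / p = x ^ r * (N ^ (p - 2) * m / p) := by rw [← hxr]; ring
  have h7 := mul_le_mul_of_nonneg_right hb hk
  unfold lineEnergy
  rw [← hN, h6, ← hxα]
  nlinarith [h5]

/-- Multiplying by `s / m ≤ 1` is exact on the mass term and only shrinks the positive one. A bound
linear in `s` can be summed over several half-lines. -/
theorem mul_lineEnergy_le {p m : ℝ} (hp : 2 < p) (hp' : p < 6) (hm : 0 < m) {M : ℝ} (hM : 0 ≤ M)
    {s : ℝ} (hs0 : 0 ≤ s) (hs : s ≤ m) :
    s / m * lineEnergy p m ≤ 2 * lineConst p * M ^ ((p + 2) / 2) - M ^ (p - 2) * s / p := by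
  have h := mul_le_mul_of_nonneg_left (lineEnergy_le hp hp' hm hM) (show 0 ≤ s / m by positivity)
  refine h.trans ?_
  have h1 : s / m * (M ^ (p - 2) * m / p) = M ^ (p - 2) * s / p := by field_simp
  have h2 : s / m * (2 * lineConst p * M ^ ((p + 2) / 2)) ≤ 2 * lineConst p * M ^ ((p + 2) / 2) := by
    have := lineConst_pos hp
    exact mul_le_of_le_one_left (by positivity) (by rw [div_le_one hm]; exact hs)
  rw [mul_sub, h1]
  linarith

/-- Lower bound for the energy on an interval in terms of the boundary values. -/
theorem energy_interval_ge {p m N : ℝ} (hp : 2 < p) (hp' : p < 6) (hm : 0 < m)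
    {v : ℝ → ℝ} {a b : ℝ} (hab : a ≤ b) (hv : AbsolutelyContinuousOnInterval v a b)
    (hd : IntervalIntegrable (fun x => deriv v x ^ 2) volume a b)
    (hN : ∀ x ∈ Icc a b, |v x| ≤ N) (hmass : ∫ x in a..b, v x ^ 2 ≤ m) :
    (∫ x in a..b, v x ^ 2) / m * lineEnergy p m
        - √(2 / p * N ^ (p - 2)) * ((v a ^ 2 + v b ^ 2) / 2) ≤
      1 / 2 * (∫ x in a..b, deriv v x ^ 2) - 1 / p * ∫ x in a..b, |v x| ^ p := by
  have hvc : ContinuousOn v (Icc a b) := by simpa [uIcc_of_le hab] using hv.continuousOn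
  -- The height is the maximum of `|v|`, so `solitonSlope_sq` applies throughout. Splitting at the
  -- maximum counts `slopePrimitive p M M` twice, for the rise and for the fall.
  obtain ⟨x₀, hx₀, hmax⟩ := isCompact_Icc.exists_isMaxOn (nonempty_Icc.2 hab) hvc.abs
  set M := |v x₀| with hM
  have hM0 : 0 ≤ M := abs_nonneg _
  have hle : ∀ x ∈ Icc a b, |v x| ≤ M := fun x hx => hmax hx
  have hΦ := hasDerivAt_slopePrimitive hp M
  have hw := continuous_solitonSlope hp M
  have ha : a ∈ Icc a b := left_mem_Icc.2 hab
  have hb : b ∈ Icc a b := right_mem_Icc.2 hab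
  have s1 : uIcc a x₀ ⊆ uIcc a b := by
    rw [uIcc_of_le hab, uIcc_of_le hx₀.1]; exact Icc_subset_Icc le_rfl hx₀.2
  have s2 : uIcc x₀ b ⊆ uIcc a b := by
    rw [uIcc_of_le hab, uIcc_of_le hx₀.2]; exact Icc_subset_Icc hx₀.1 le_rfl
  have h1 := abs_comp_sub_le_of_ac hΦ hw hx₀.1 (hv.mono s1) (hd.mono_set s1)
  have h2 := abs_comp_sub_le_of_ac hΦ hw hx₀.2 (hv.mono s2) (hd.mono_set s2)
  have hvc' : ContinuousOn v (uIcc a b) := hv.continuousOn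
  have hwi : IntervalIntegrable (fun x => solitonSlope p M (v x) ^ 2) volume a b :=
    ((hw.comp_continuousOn hvc').pow 2).intervalIntegrable
  have e1 := intervalIntegral.integral_add_adjacent_intervals (hd.mono_set s1) (hd.mono_set s2)
  have e2 := intervalIntegral.integral_add_adjacent_intervals (hwi.mono_set s1) (hwi.mono_set s2)
  have hi2 : IntervalIntegrable (fun x => v x ^ 2) volume a b := (hvc'.pow 2).intervalIntegrable
  have hip : IntervalIntegrable (fun x => |v x| ^ p) volume a b :=
    (hvc'.abs.rpow_const fun _ _ => Or.inr (by linarith)).intervalIntegrable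
  have e3 : ∫ x in a..b, solitonSlope p M (v x) ^ 2 =
      2 / p * (M ^ (p - 2) * (∫ x in a..b, v x ^ 2) - ∫ x in a..b, |v x| ^ p) := by
    rw [← intervalIntegral.integral_const_mul, ← intervalIntegral.integral_sub (hi2.const_mul _) hip,
      ← intervalIntegral.integral_const_mul]
    refine intervalIntegral.integral_congr fun x hx => ?_
    rw [uIcc_of_le hab] at hx
    exact solitonSlope_sq hp (hle x hx)
  have t1 : slopePrimitive p M M - slopePrimitive p M |v a| ≤
      |slopePrimitive p M (v x₀) - slopePrimitive p M (v a)| := by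
    rw [← abs_slopePrimitive p M (v a), hM, ← abs_slopePrimitive p _ (v x₀)]
    exact abs_sub_abs_le_abs_sub _ _
  have t2 : slopePrimitive p M M - slopePrimitive p M |v b| ≤
      |slopePrimitive p M (v b) - slopePrimitive p M (v x₀)| := by
    rw [← abs_slopePrimitive p M (v b), hM, ← abs_slopePrimitive p _ (v x₀), abs_sub_comm]
    exact abs_sub_abs_le_abs_sub _ _
  -- Boundary terms are expressed through `N`, which is uniform along a sequence, unlike the maximum
  -- `M`.
  have hs : ∀ y, slopePrimitive p M |y| ≤ √(2 / p * N ^ (p - 2)) * (y ^ 2 / 2) := by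
    intro y
    refine (slopePrimitive_le hp (abs_nonneg y)).trans ?_
    rw [sq_abs]
    refine mul_le_mul_of_nonneg_right (Real.sqrt_le_sqrt ?_) (by positivity)
    exact mul_le_mul_of_nonneg_left (Real.rpow_le_rpow hM0 (hN x₀ hx₀) (by linarith))
      (by positivity)
  have hself : slopePrimitive p M M = lineConst p * M ^ ((p + 2) / 2) := by
    rcases hM0.eq_or_lt with h0 | h0
    · rw [← h0, Real.zero_rpow (by linarith)]; simp [slopePrimitive]
    · exact slopePrimitive_self h0
  have hs0 : 0 ≤ ∫ x in a..b, v x ^ 2 :=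
    intervalIntegral.integral_nonneg hab fun _ _ => sq_nonneg _
  have hg := mul_lineEnergy_le hp hp' hm hM0 hs0 hmass
  have ha' := hs (v a)
  have hb' := hs (v b)
  have e4 : 1 / 2 * (2 / p * (M ^ (p - 2) * (∫ x in a..b, v x ^ 2) - ∫ x in a..b, |v x| ^ p)) =
      M ^ (p - 2) * (∫ x in a..b, v x ^ 2) / p - 1 / p * ∫ x in a..b, |v x| ^ p := by
    field_simp
  rw [e3] at e2
  linarith

/-! ### `H¹` functions on an edge -/

/-- `H¹` functions on an edge, where `S` is an interval `(0, ℓ)` or the half-line `(0, ∞)`. -/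
structure EdgeH1 (S : Set ℝ) (v : ℝ → ℝ) : Prop where
  ac : ∀ T, 0 ≤ T → Ioo 0 T ⊆ S → AbsolutelyContinuousOnInterval v 0 T
  memLp : MemLp v 2 (volume.restrict S)
  deriv_memLp : MemLp (deriv v) 2 (volume.restrict S)

theorem intervalIntegrable_of_Ioo_subset {S : Set ℝ} {f : ℝ → ℝ} {a b : ℝ} (hab : a ≤ b)
    (hf : IntegrableOn f S) (h : Ioo a b ⊆ S) : IntervalIntegrable f volume a b := by
  rw [intervalIntegrable_iff_integrableOn_Ioo_of_le hab]
  exact hf.mono_set h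

theorem intervalIntegral_le_setIntegral {S : Set ℝ} {f : ℝ → ℝ} {a b : ℝ} (hab : a ≤ b)
    (hf : IntegrableOn f S) (h : Ioo a b ⊆ S) (h0 : ∀ x, 0 ≤ f x) :
    ∫ x in a..b, f x ≤ ∫ x in S, f x := by
  rw [intervalIntegral.integral_of_le hab, integral_Ioc_eq_integral_Ioo]
  exact setIntegral_mono_set hf (Eventually.of_forall h0) (Eventually.of_forall h)

theorem EdgeH1.sq_le {S : Set ℝ} {v : ℝ → ℝ} (hv : EdgeH1 S v) {ℓ : ℝ} (hℓ : 0 < ℓ)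
    (hℓS : Ioo 0 ℓ ⊆ S) {t : ℝ} (ht : 0 < t) {x : ℝ} (hx : 0 ≤ x) (hxS : Ioo 0 x ⊆ S) :
    v x ^ 2 ≤ (ℓ⁻¹ + t) * (∫ y in S, v y ^ 2) + t⁻¹ * ∫ y in S, deriv v y ^ 2 := by
  -- Working on an interval of length at least `ℓ` keeps the factor `(b - a)⁻¹` bounded when `x` is
  -- small.
  have hT : 0 < max x ℓ := lt_max_of_lt_right hℓ
  have hTS : Ioo 0 (max x ℓ) ⊆ S := by
    rcases max_choice x ℓ with h | h <;> rw [h] <;> assumption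
  have hd := hv.deriv_memLp.integrable_sq
  have h2 := hv.memLp.integrable_sq
  have h := sq_le_of_ac hT (hv.ac _ hT.le hTS) (intervalIntegrable_of_Ioo_subset hT.le hd hTS) ht
    (x := x) ⟨hx, le_max_left _ _⟩
  refine h.trans ?_
  have i1 := intervalIntegral_le_setIntegral hT.le h2 hTS fun x => sq_nonneg _
  have i2 := intervalIntegral_le_setIntegral hT.le hd hTS fun x => sq_nonneg _
  have i3 : (max x ℓ - 0)⁻¹ ≤ ℓ⁻¹ := by
    rw [sub_zero]; exact inv_anti₀ hℓ (le_max_right _ _)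
  have i4 : 0 ≤ ∫ y in (0 : ℝ)..max x ℓ, v y ^ 2 :=
    intervalIntegral.integral_nonneg hT.le fun _ _ => sq_nonneg _
  have i5 : 0 ≤ ℓ⁻¹ + t := by positivity
  have i6 : 0 ≤ t⁻¹ := by positivity
  calc _ ≤ (ℓ⁻¹ + t) * (∫ y in (0 : ℝ)..max x ℓ, v y ^ 2) +
        t⁻¹ * ∫ y in (0 : ℝ)..max x ℓ, deriv v y ^ 2 := by gcongr
    _ ≤ _ := by gcongr

/-- `v T ^ 2` is at most twice the mass plus the kinetic energy on `[T, T + 1]`, and both tend to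
zero as differences of convergent integrals. -/
theorem EdgeH1.tendsto_zero {v : ℝ → ℝ} (hv : EdgeH1 (Ioi 0) v) : Tendsto v atTop (𝓝 0) := by
  have hd := hv.deriv_memLp.integrable_sq
  have h2 := hv.memLp.integrable_sq
  have key : ∀ f : ℝ → ℝ, IntegrableOn f (Ioi 0) →
      Tendsto (fun T : ℝ => ∫ x in T..(T + 1), f x) atTop (𝓝 0) := by
    intro f hf
    have t1 := intervalIntegral_tendsto_integral_Ioi 0 hf tendsto_id
    have t2 := intervalIntegral_tendsto_integral_Ioi 0 hf (tendsto_atTop_add_const_right atTop 1 tendsto_id)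
    have t3 := t2.sub t1
    rw [sub_self] at t3
    refine t3.congr' ?_
    filter_upwards [eventually_ge_atTop 0] with T hT
    have hI : ∀ T : ℝ, 0 ≤ T → IntervalIntegrable f volume 0 T := fun T hT =>
      intervalIntegrable_of_Ioo_subset hT hf Ioo_subset_Ioi_self
    exact intervalIntegral.integral_interval_sub_left (hI (T + 1) (by linarith)) (hI T hT)
  have hlim := ((key _ h2).const_mul 2).add (key _ hd)
  rw [mul_zero, add_zero] at hlim
  have hsq : Tendsto (fun T => v T ^ 2) atTop (𝓝 0) := by
    refine squeeze_zero' (Eventually.of_forall fun T => sq_nonneg _) ?_ hlim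
    filter_upwards [eventually_ge_atTop 0] with T hT
    have hsub : uIcc T (T + 1) ⊆ uIcc 0 (T + 1) := by
      rw [uIcc_of_le (by linarith), uIcc_of_le (by linarith)]
      exact Icc_subset_Icc_left hT
    have h := sq_le_of_ac (by linarith : T < T + 1)
      ((hv.ac (T + 1) (by linarith) Ioo_subset_Ioi_self).mono hsub)
      (intervalIntegrable_of_Ioo_subset (by linarith) hd
        ((Ioo_subset_Ioo_left hT).trans Ioo_subset_Ioi_self)) one_pos (x := T) ⟨le_rfl, by linarith⟩
    convert! h using 1
    norm_num
  have := (hsq.sqrt)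
  simp only [Real.sqrt_sq_eq_abs, Real.sqrt_zero] at this
  exact (tendsto_zero_iff_abs_tendsto_zero _).2 this

theorem abs_rpow_le {p N s : ℝ} (hp : 2 < p) (hs : |s| ≤ N) : |s| ^ p ≤ N ^ (p - 2) * s ^ 2 := by
  rcases eq_or_ne s 0 with rfl | h
  · simp [Real.zero_rpow (show p ≠ 0 by linarith)]
  · have h3 : |s| ^ p = |s| ^ (p - 2) * s ^ 2 := by
      rw [← sq_abs s, ← Real.rpow_natCast |s| 2, ← Real.rpow_add (abs_pos.2 h)]
      congr 1; push_cast; ring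
    rw [h3]
    exact mul_le_mul_of_nonneg_right (Real.rpow_le_rpow (abs_nonneg _) hs (by linarith))
      (sq_nonneg _)

theorem EdgeH1.integrableOn_rpow {S : Set ℝ} (hS : MeasurableSet S) {v : ℝ → ℝ} (hv : EdgeH1 S v)
    {p N : ℝ} (hp : 2 < p) (hN : ∀ x ∈ S, |v x| ≤ N) : IntegrableOn (fun x => |v x| ^ p) S := by
  refine Integrable.mono' (hv.memLp.integrable_sq.const_mul (N ^ (p - 2))) ?_ ?_
  · exact ((Real.continuous_rpow_const (by linarith)).comp continuous_abs).comp_aestronglyMeasurable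
      hv.memLp.1
  · filter_upwards [ae_restrict_mem hS] with x hx
    rw [Real.norm_of_nonneg (by positivity)]
    exact abs_rpow_le hp (hN x hx)

/-- Lower bound for the energy at the end of a half-line. -/
theorem energy_tail_ge {p m N : ℝ} (hp : 2 < p) (hp' : p < 6) (hm : 0 < m)
    {v : ℝ → ℝ} (hv : EdgeH1 (Ioi 0) v) {R : ℝ} (hR : 0 ≤ R)
    (hN : ∀ x ∈ Ici (0 : ℝ), |v x| ≤ N) (hmass : ∫ x in Ioi R, v x ^ 2 ≤ m) :
    (∫ x in Ioi R, v x ^ 2) / m * lineEnergy p m - √(2 / p * N ^ (p - 2)) * (v R ^ 2 / 2) ≤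
      1 / 2 * (∫ x in Ioi R, deriv v x ^ 2) - 1 / p * ∫ x in Ioi R, |v x| ^ p := by
  have hsub : Ioi R ⊆ Ioi 0 := Ioi_subset_Ioi hR
  have hd : IntegrableOn (fun x => deriv v x ^ 2) (Ioi R) :=
    IntegrableOn.mono_set hv.deriv_memLp.integrable_sq hsub
  have h2 : IntegrableOn (fun x => v x ^ 2) (Ioi R) :=
    IntegrableOn.mono_set hv.memLp.integrable_sq hsub
  have hpi : IntegrableOn (fun x => |v x| ^ p) (Ioi R) :=
    (hv.integrableOn_rpow measurableSet_Ioi hp fun x hx => hN x (mem_Ici.2 (le_of_lt (mem_Ioi.1 hx)))).mono_set hsub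
  have l1 := intervalIntegral_tendsto_integral_Ioi R h2 tendsto_id
  have l2 := intervalIntegral_tendsto_integral_Ioi R hd tendsto_id
  have l3 := intervalIntegral_tendsto_integral_Ioi R hpi tendsto_id
  have lv := (hv.tendsto_zero.pow 2).const_add (v R ^ 2)
  have L := ((l1.div_const m).mul_const (lineEnergy p m)).sub
    ((lv.div_const 2).const_mul √(2 / p * N ^ (p - 2)))
  have L' := (l2.const_mul (1 / 2)).sub (l3.const_mul (1 / p))
  -- The interval bound on `[R, T]` passes to `T → ∞`; its boundary term at `T` vanishes in the
  -- limit.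
  have := le_of_tendsto_of_tendsto L L' ?_
  · convert! this using 4
    norm_num
  filter_upwards [eventually_ge_atTop R] with T hT
  have hac : AbsolutelyContinuousOnInterval v R T :=
    (hv.ac T (hR.trans hT) Ioo_subset_Ioi_self).mono (by
      rw [uIcc_of_le hT, uIcc_of_le (hR.trans hT)]; exact Icc_subset_Icc_left hR)
  exact energy_interval_ge hp hp' hm hT hac
    (intervalIntegrable_of_Ioo_subset hT hd Ioo_subset_Ioi_self)
    (fun x hx => hN x (hR.trans hx.1))
    ((intervalIntegral_le_setIntegral hT h2 Ioo_subset_Ioi_self fun _ => sq_nonneg _).trans hmass)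

/-! ### Weak compactness -/

/-- Sequential Banach–Alaoglu in the dual of the separable space `L²(S)`, transported by the Riesz
isometry. -/
theorem exists_weakly_convergent_subseq {S : Set ℝ} {f : ℕ → ℝ → ℝ}
    (hf : ∀ k, MemLp (f k) 2 (volume.restrict S)) {C : ℝ} (hC : ∀ k, ∫ x in S, f k x ^ 2 ≤ C) :
    ∃ g : ℝ → ℝ, MemLp g 2 (volume.restrict S) ∧ ∃ φ : ℕ → ℕ, StrictMono φ ∧
      ∀ h : ℝ → ℝ, MemLp h 2 (volume.restrict S) →
        Tendsto (fun k => ∫ x in S, f (φ k) x * h x) atTop (𝓝 (∫ x in S, g x * h x)) := by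
  have : Fact ((2 : ENNReal) ≠ ⊤) := ⟨by simp⟩
  let E := Lp ℝ 2 (volume.restrict S : Measure ℝ)
  let F : ℕ → E := fun k => (hf k).toLp (f k)
  let D := InnerProductSpace.toDual ℝ E
  have hinner : ∀ a b : ℝ → ℝ, ∀ (ha : MemLp a 2 (volume.restrict S))
      (hb : MemLp b 2 (volume.restrict S)),
      inner ℝ (ha.toLp a) (hb.toLp b) = ∫ x in S, a x * b x := by
    intro a b ha hb
    rw [L2.inner_def]
    refine integral_congr_ae ?_
    filter_upwards [ha.coeFn_toLp, hb.coeFn_toLp] with x h1 h2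
    rw [h1, h2]; simp [mul_comm]
  have hnorm : ∀ k, ‖F k‖ ≤ √C := by
    intro k
    refine Real.le_sqrt_of_sq_le ?_
    rw [← real_inner_self_eq_norm_sq, hinner]
    simpa [sq] using hC k
  have hseq := WeakDual.isSeqCompact_closedBall ℝ E (0 : StrongDual ℝ E) √C
  obtain ⟨a, -, φ, hφ, hlim⟩ := hseq (x := fun k => StrongDual.toWeakDual (D (F k))) (fun k => by
    simpa [D] using hnorm k)
  let G : E := D.symm (WeakDual.toStrongDual a)
  refine ⟨G, Lp.memLp G, φ, hφ, fun h hh => ?_⟩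
  have h1 := ((WeakDual.eval_continuous (𝕜 := ℝ) (hh.toLp h)).tendsto a).comp hlim
  have h2 : (a : WeakDual ℝ E) (hh.toLp h) = ∫ x in S, G x * h x := by
    have : WeakDual.toStrongDual a = D G := (D.apply_symm_apply _).symm
    have h3 : (a : WeakDual ℝ E) (hh.toLp h) = inner ℝ G (hh.toLp h) := by
      change (WeakDual.toStrongDual a) (hh.toLp h) = _
      rw [this]; simp [D]
    rw [h3, ← hinner _ _ (Lp.memLp G) hh, Lp.toLp_coeFn]
  rw [h2] at h1
  refine h1.congr fun k => ?_
  rw [← hinner _ _ (hf _) hh]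
  exact (InnerProductSpace.toDual_apply_apply (𝕜 := ℝ) (x := F (φ k)) (y := hh.toLp h)).symm

/-- Convergence of functions on an edge: pointwise, with a limit in `H¹` whose kinetic energy is
lower semicontinuous on all initial segments. -/
structure EdgeConv (S : Set ℝ) (v : ℕ → ℝ → ℝ) (u : ℝ → ℝ) : Prop where
  edgeH1 : EdgeH1 S u
  tendsto : ∀ x, 0 ≤ x → Ioo 0 x ⊆ S → Tendsto (fun k => v k x) atTop (𝓝 (u x))
  lsc : ∀ R, 0 ≤ R → Ioo 0 R ⊆ S → ∀ ε > 0,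
    ∀ᶠ k in atTop, (∫ x in Ioo 0 R, deriv u x ^ 2) - ε ≤ ∫ x in Ioo 0 R, deriv (v k) x ^ 2

theorem EdgeConv.comp {S : Set ℝ} {v : ℕ → ℝ → ℝ} {u : ℝ → ℝ} (h : EdgeConv S v u) {ψ : ℕ → ℕ}
    (hψ : StrictMono ψ) : EdgeConv S (fun k => v (ψ k)) u :=
  ⟨h.edgeH1, fun x hx hxS => (h.tendsto x hx hxS).comp hψ.tendsto_atTop,
    fun R hR hRS ε hε => hψ.tendsto_atTop.eventually (h.lsc R hR hRS ε hε)⟩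

/-- Fatou's lemma for the `L²` norm. -/
theorem memLp_two_of_tendsto {S : Set ℝ} {v : ℕ → ℝ → ℝ} {u : ℝ → ℝ} {C : ℝ}
    (hv : ∀ k, MemLp (v k) 2 (volume.restrict S)) (hC : ∀ k, ∫ x in S, v k x ^ 2 ≤ C)
    (hu : AEStronglyMeasurable u (volume.restrict S))
    (hlim : ∀ᵐ x ∂(volume.restrict S), Tendsto (fun k => v k x) atTop (𝓝 (u x))) :
    MemLp u 2 (volume.restrict S) := by
  refine ⟨hu, lt_of_le_of_lt (Lp.eLpNorm_le_of_ae_tendsto (C := ENNReal.ofReal (C ^ (1 / 2 : ℝ)))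
    (Eventually.of_forall fun k => ?_) (fun k => (hv k).1) hlim) ENNReal.ofReal_lt_top⟩
  rw [(hv k).eLpNorm_eq_integral_rpow_norm (by simp) (by simp)]
  refine ENNReal.ofReal_le_ofReal ?_
  simp only [ENNReal.toReal_ofNat, Real.rpow_two, Real.norm_eq_abs, sq_abs, one_div]
  exact Real.rpow_le_rpow (integral_nonneg fun _ => sq_nonneg _) (hC k) (by positivity)

/-- The limit is `c` plus the primitive of the weak limit `g` of the derivatives. Testing against
the indicator of `(0, x)` gives pointwise convergence; testing against `g` on `(0, R)` gives lower
semicontinuity. -/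
theorem exists_edgeConv {S : Set ℝ} (hSm : MeasurableSet S)
    (hS : ∀ x ∈ S, 0 < x ∧ Ioo 0 x ⊆ S) {v : ℕ → ℝ → ℝ} (hv : ∀ k, EdgeH1 S (v k)) {C c : ℝ}
    (hC : ∀ k, ∫ x in S, v k x ^ 2 ≤ C) (hC' : ∀ k, ∫ x in S, deriv (v k) x ^ 2 ≤ C)
    (h0 : Tendsto (fun k => v k 0) atTop (𝓝 c)) :
    ∃ φ : ℕ → ℕ, StrictMono φ ∧ ∃ u, EdgeConv S (fun k => v (φ k)) u := by
  obtain ⟨g₀, hg₀, φ, hφ, hweak₀⟩ :=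
    exists_weakly_convergent_subseq (fun k => (hv k).deriv_memLp) hC'
  -- Extended by zero, the weak limit is locally integrable on `ℝ`, so its primitive is continuous
  -- and differentiable almost everywhere.
  set g := S.indicator g₀ with hg
  have hgL : MemLp g 2 volume := (memLp_indicator_iff_restrict hSm).2 hg₀
  have hgS : ∀ h : ℝ → ℝ, ∫ x in S, g x * h x = ∫ x in S, g₀ x * h x := fun h =>
    setIntegral_congr_fun hSm fun x hx => by simp [hg, hx]
  have hweak : ∀ h : ℝ → ℝ, MemLp h 2 (volume.restrict S) →
      Tendsto (fun k => ∫ x in S, deriv (v (φ k)) x * h x) atTop (𝓝 (∫ x in S, g x * h x)) := by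
    intro h hh
    rw [hgS]
    exact hweak₀ h hh
  have hloc : LocallyIntegrable g volume := hgL.locallyIntegrable (by norm_num)
  have hii : ∀ a b : ℝ, IntervalIntegrable g volume a b := fun a b =>
    (hloc.integrableOn_isCompact isCompact_uIcc).intervalIntegrable
  set u : ℝ → ℝ := fun x => c + ∫ t in (0 : ℝ)..x, g t with hu
  have hder : ∀ᵐ x, deriv u x = g x := by
    filter_upwards [LocallyIntegrable.ae_hasDerivAt_integral hloc] with x hx
    exact ((hx 0).const_add c).deriv
  have hucont : Continuous u := continuous_const.add (intervalIntegral.continuous_primitive hii 0)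
  have hlim : ∀ x, 0 ≤ x → Ioo 0 x ⊆ S → Tendsto (fun k => v (φ k) x) atTop (𝓝 (u x)) := by
    intro x hx hxS
    have hind : MemLp ((Ioo 0 x).indicator fun _ => (1 : ℝ)) 2 (volume.restrict S) :=
      (memLp_indicator_const 2 measurableSet_Ioo 1 (Or.inr (by simp))).restrict S
    have e : ∀ f : ℝ → ℝ, ∫ y in S, f y * (Ioo 0 x).indicator (fun _ => (1 : ℝ)) y =
        ∫ y in (0 : ℝ)..x, f y := by
      intro f
      rw [intervalIntegral.integral_of_le hx, integral_Ioc_eq_integral_Ioo,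
        ← inter_eq_self_of_subset_right hxS, ← setIntegral_indicator measurableSet_Ioo]
      refine integral_congr_ae (Eventually.of_forall fun y => ?_)
      simp only [indicator_apply, inter_eq_self_of_subset_right hxS]
      split_ifs <;> simp
    have h1 := hweak _ hind
    simp only [e] at h1
    have h2 := (h0.comp hφ.tendsto_atTop).add h1
    refine h2.congr fun k => ?_
    rw [((hv (φ k)).ac x hx hxS).integral_deriv_eq_sub]
    simp
  have huH : EdgeH1 S u := by
    refine ⟨fun T hT hTS => ?_, ?_, ?_⟩
    · have h1 : AbsolutelyContinuousOnInterval (fun _ : ℝ => c) 0 T :=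
        (contDiffOn_const (n := 1)).absolutelyContinuousOnInterval
      exact h1.add ((hii 0 T).absolutelyContinuousOnInterval_intervalIntegral left_mem_uIcc)
    · refine memLp_two_of_tendsto (fun k => (hv (φ k)).memLp) (fun k => hC (φ k))
        hucont.aestronglyMeasurable ?_
      filter_upwards [ae_restrict_mem hSm] with x hx
      exact hlim x (hS x hx).1.le (hS x hx).2
    · exact (memLp_congr_ae (ae_restrict_of_ae hder)).2 (hgL.restrict S)
  refine ⟨φ, hφ, u, huH, hlim, fun R hR hRS ε hε => ?_⟩
  have hgi : MemLp ((Ioo 0 R).indicator g) 2 (volume.restrict S) :=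
    (hgL.indicator measurableSet_Ioo).restrict S
  have e : ∀ f : ℝ → ℝ, ∫ y in S, f y * (Ioo 0 R).indicator g y = ∫ y in Ioo 0 R, f y * g y := by
    intro f
    rw [← inter_eq_self_of_subset_right hRS, ← setIntegral_indicator measurableSet_Ioo]
    refine integral_congr_ae (Eventually.of_forall fun y => ?_)
    simp only [indicator_apply, inter_eq_self_of_subset_right hRS]
    split_ifs <;> simp
  have h1 := hweak _ hgi
  simp only [e] at h1
  have hdu : ∫ x in Ioo 0 R, deriv u x ^ 2 = ∫ x in Ioo 0 R, g x * g x := by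
    refine integral_congr_ae ?_
    filter_upwards [ae_restrict_of_ae hder] with x hx
    rw [hx, sq]
  have hgR : MemLp g 2 (volume.restrict (Ioo 0 R)) := hgL.restrict _
  filter_upwards [h1.eventually (lt_mem_nhds (show (∫ x in Ioo 0 R, g x * g x) - ε / 2 <
    ∫ x in Ioo 0 R, g x * g x by linarith))] with k hk
  have hvR : MemLp (deriv (v (φ k))) 2 (volume.restrict (Ioo 0 R)) :=
    (hv (φ k)).deriv_memLp.mono_measure (Measure.restrict_mono hRS le_rfl)
  have i1 : Integrable (fun x => deriv (v (φ k)) x * g x) (volume.restrict (Ioo 0 R)) :=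
    hvR.integrable_mul hgR
  have i2 : Integrable (fun x => g x * g x) (volume.restrict (Ioo 0 R)) := hgR.integrable_mul hgR
  -- The integrated form of `(v' - g)² ≥ 0`.
  have h3 : ∫ x in Ioo 0 R, (2 * (deriv (v (φ k)) x * g x) - g x * g x) ≤
      ∫ x in Ioo 0 R, deriv (v (φ k)) x ^ 2 := by
    refine integral_mono ((i1.const_mul 2).sub i2) hvR.integrable_sq fun x => ?_
    simp only
    nlinarith [sq_nonneg (deriv (v (φ k)) x - g x)]
  rw [integral_sub (i1.const_mul 2) i2, integral_const_mul] at h3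
  rw [hdu]
  linarith

/-- Finitely many extractions made one after another; `hsub` keeps the properties already secured.
-/
theorem exists_common_subseq {ι : Type*} [Finite ι] (P : ι → (ℕ → ℕ) → Prop)
    (hsub : ∀ (i : ι) (φ ψ : ℕ → ℕ), P i φ → StrictMono ψ → P i (φ ∘ ψ))
    (hex : ∀ (i : ι) (φ : ℕ → ℕ), StrictMono φ → ∃ ψ : ℕ → ℕ, StrictMono ψ ∧ P i (φ ∘ ψ)) :
    ∃ φ : ℕ → ℕ, StrictMono φ ∧ ∀ i, P i φ := by
  classical
  have := Fintype.ofFinite ι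
  have key : ∀ s : Finset ι, ∃ φ : ℕ → ℕ, StrictMono φ ∧ ∀ i ∈ s, P i φ := by
    intro s
    induction s using Finset.induction_on with
    | empty => exact ⟨id, strictMono_id, by simp⟩
    | insert a s _ ih =>
      obtain ⟨φ, hφ, h⟩ := ih
      obtain ⟨ψ, hψ, h'⟩ := hex a φ hφ
      refine ⟨φ ∘ ψ, hφ.comp hψ, fun i hi => ?_⟩
      rcases Finset.mem_insert.1 hi with rfl | hi
      · exact h'
      · exact hsub _ _ _ (h i hi) hψ
  obtain ⟨φ, hφ, h⟩ := key Finset.univ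
  exact ⟨φ, hφ, fun i => h i (Finset.mem_univ i)⟩

/-- Convergence of the integrals over bounded initial segments. -/
theorem EdgeConv.tendsto_integral {S : Set ℝ} {v : ℕ → ℝ → ℝ} {u : ℝ → ℝ} (h : EdgeConv S v u)
    (hv : ∀ k, EdgeH1 S (v k)) {N : ℝ} (hN : ∀ k x, 0 ≤ x → Ioo 0 x ⊆ S → |v k x| ≤ N)
    {R : ℝ} (hRS : Ioo 0 R ⊆ S) {r : ℝ} (hr : 0 ≤ r) :
    Tendsto (fun k => ∫ x in Ioo 0 R, |v k x| ^ r) atTop (𝓝 (∫ x in Ioo 0 R, |u x| ^ r)) := by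
  have hx : ∀ᵐ x ∂(volume.restrict (Ioo 0 R)), 0 ≤ x ∧ Ioo 0 x ⊆ S := by
    filter_upwards [ae_restrict_mem measurableSet_Ioo] with x hx
    exact ⟨hx.1.le, (Ioo_subset_Ioo_right hx.2.le).trans hRS⟩
  refine tendsto_integral_of_dominated_convergence (fun _ => N ^ r) (fun k => ?_) ?_ (fun k => ?_) ?_
  · exact ((Real.continuous_rpow_const hr).comp continuous_abs).comp_aestronglyMeasurable
      ((hv k).memLp.1.mono_measure (Measure.restrict_mono hRS le_rfl))
  · exact integrable_const _
  · filter_upwards [hx] with x hx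
    rw [Real.norm_of_nonneg (by positivity)]
    exact Real.rpow_le_rpow (abs_nonneg _) (hN k x hx.1 hx.2) hr
  · filter_upwards [hx] with x hx
    exact ((Real.continuous_rpow_const hr).comp continuous_abs).continuousAt.tendsto.comp
      (h.tendsto x hx.1 hx.2)

/-! ### Functions on the graph -/

variable {V B H : Type*}

/-- The coordinate interval of an edge, bounded or unbounded. -/
def arcDomain (G : MetricGraph V B H) : B ⊕ H → Set ℝ :=
  Sum.elim (fun e => Ioo 0 (G.length e)) (fun _ => Ioi 0)

/-- The function on an edge, bounded or unbounded. -/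
def _root_.GraphFun.onArc (u : GraphFun V B H) : B ⊕ H → ℝ → ℝ := Sum.elim u.onEdge u.onHalf

theorem measurableSet_arcDomain (G : MetricGraph V B H) (i : B ⊕ H) :
    MeasurableSet (G.arcDomain i) := by
  cases i
  · exact measurableSet_Ioo
  · exact measurableSet_Ioi

theorem arcDomain_spec (G : MetricGraph V B H) (i : B ⊕ H) :
    ∀ x ∈ G.arcDomain i, 0 < x ∧ Ioo 0 x ⊆ G.arcDomain i := by
  intro x hx
  cases i with
  | inl e => exact ⟨hx.1, Ioo_subset_Ioo_right (le_of_lt hx.2)⟩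
  | inr h => exact ⟨hx, Ioo_subset_Ioi_self⟩

theorem le_length_of_Ioo_subset (G : MetricGraph V B H) {e : B} {T : ℝ}
    (h : Ioo 0 T ⊆ G.arcDomain (.inl e)) : T ≤ G.length e := by
  by_contra hlt
  push Not at hlt
  have h0 := G.length_pos e
  exact lt_irrefl _ (h (show G.length e ∈ Ioo 0 T from ⟨h0, hlt⟩)).2

theorem MemH1.edgeH1 {G : MetricGraph V B H} {u : GraphFun V B H} (hu : G.MemH1 u) (i : B ⊕ H) :
    EdgeH1 (G.arcDomain i) (u.onArc i) := by
  cases i with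
  | inl e =>
    refine ⟨fun T hT h => (hu.edge_ac e).mono ?_, hu.edge_memLp e, hu.edge_deriv e⟩
    have := G.le_length_of_Ioo_subset h
    rw [uIcc_of_le hT, uIcc_of_le (hT.trans this)]
    exact Icc_subset_Icc_right this
  | inr h =>
    refine ⟨fun T hT _ => (hu.half_ac h (T + 1) (by linarith)).mono ?_, hu.half_memLp h,
      hu.half_deriv h⟩
    rw [uIcc_of_le hT, uIcc_of_le (by linarith)]
    exact Icc_subset_Icc_right (by linarith)

theorem MemH1.of_edgeH1 {G : MetricGraph V B H} {u : GraphFun V B H}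
    (h : ∀ i, EdgeH1 (G.arcDomain i) (u.onArc i))
    (h1 : ∀ e, u.onEdge e 0 = u.onVertex (G.src e))
    (h2 : ∀ e, u.onEdge e (G.length e) = u.onVertex (G.tgt e))
    (h3 : ∀ h, u.onHalf h 0 = u.onVertex (G.base h)) : G.MemH1 u where
  edge_src := h1
  edge_tgt := h2
  half_base := h3
  edge_ac e := (h (.inl e)).ac _ (G.length_pos e).le le_rfl
  edge_memLp e := (h (.inl e)).memLp
  edge_deriv e := (h (.inl e)).deriv_memLp
  half_ac e _ hR := (h (.inr e)).ac _ hR.le Ioo_subset_Ioi_self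
  half_memLp e := (h (.inr e)).memLp
  half_deriv e := (h (.inr e)).deriv_memLp

/-- Every vertex is an endpoint of an edge. -/
theorem AssumptionH.exists_arc {G : MetricGraph V B H} (hH : G.AssumptionH) (v : V) :
    ∃ (i : B ⊕ H) (x : ℝ), 0 ≤ x ∧ Ioo 0 x ⊆ G.arcDomain i ∧
      ∀ u : GraphFun V B H, G.MemH1 u → u.onVertex v = u.onArc i x := by
  have hbase : ∀ h, v = G.base h → ∃ (i : B ⊕ H) (x : ℝ), 0 ≤ x ∧ Ioo 0 x ⊆ G.arcDomain i ∧
      ∀ u : GraphFun V B H, G.MemH1 u → u.onVertex v = u.onArc i x := by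
    rintro h rfl
    exact ⟨.inr h, 0, le_rfl, by simp, fun u hu => (hu.half_base h).symm⟩
  obtain ⟨T, hT⟩ := hH (.vertex v)
  rcases hT with h | h | ⟨e, -, h | h⟩
  · exact hbase _ h
  · exact hbase _ h
  · exact ⟨.inl e, 0, le_rfl, by simp, fun u hu => by rw [h]; exact (hu.edge_src e).symm⟩
  · exact ⟨.inl e, G.length e, (G.length_pos e).le, le_rfl, fun u hu => by
      rw [h]; exact (hu.edge_tgt e).symm⟩

/-- Multiplication of a function by a constant. -/
def smulFun (t : ℝ) (u : GraphFun V B H) : GraphFun V B H where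
  onVertex v := t * u.onVertex v
  onEdge e x := t * u.onEdge e x
  onHalf h x := t * u.onHalf h x

theorem smulFun_onArc (t : ℝ) (u : GraphFun V B H) (i : B ⊕ H) :
    (smulFun t u).onArc i = fun x => t * u.onArc i x := by
  cases i <;> rfl

theorem deriv_smulFun_onArc (t : ℝ) (u : GraphFun V B H) (i : B ⊕ H) :
    deriv ((smulFun t u).onArc i) = fun x => t * deriv (u.onArc i) x := by
  rw [smulFun_onArc]
  ext x
  exact deriv_const_mul_field t

theorem MemH1.smulFun {G : MetricGraph V B H} {u : GraphFun V B H} (hu : G.MemH1 u) (t : ℝ) :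
    G.MemH1 (smulFun t u) := by
  refine .of_edgeH1 (fun i => ⟨fun T hT h => ?_, ?_, ?_⟩)
    (fun e => congrArg (t * ·) (hu.edge_src e)) (fun e => congrArg (t * ·) (hu.edge_tgt e))
    (fun e => congrArg (t * ·) (hu.half_base e))
  · rw [smulFun_onArc]; exact ((hu.edgeH1 i).ac T hT h).const_mul t
  · rw [smulFun_onArc]; exact (hu.edgeH1 i).memLp.const_mul t
  · rw [deriv_smulFun_onArc]; exact (hu.edgeH1 i).deriv_memLp.const_mul t

/-- Bernoulli's inequality at the scale `l`, with `l ^ (1 - r) = 8 * (c + 1)` so that the slope `c *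
l ^ (r - 1)` is below `1 / 8`. Two such terms then use up only half of the `1 / 2` in front of the
kinetic energy. -/
theorem exists_mul_rpow_le {r c : ℝ} (hr0 : 0 ≤ r) (hr : r < 1) (hc : 0 ≤ c) :
    ∃ C : ℝ, ∀ x : ℝ, 0 ≤ x → c * x ^ r ≤ x / 8 + C := by
  set l : ℝ := (8 * (c + 1)) ^ (1 / (1 - r)) with hl
  have h1r : 0 < 1 - r := by linarith
  have hl0 : 0 < l := by positivity
  have hl1 : l ^ (1 - r) = 8 * (c + 1) := by
    rw [hl, ← Real.rpow_mul (by positivity), one_div_mul_cancel h1r.ne', Real.rpow_one]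
  have hl2 : l = l ^ (1 - r) * l ^ r := by
    rw [← Real.rpow_add hl0]; simp
  refine ⟨c * l ^ r, fun x hx => ?_⟩
  have hb := rpow_one_add_le_one_add_mul_self (s := x / l - 1)
    (by linarith [show 0 ≤ x / l by positivity]) hr0 hr.le
  rw [show 1 + (x / l - 1) = x / l by ring, Real.div_rpow hx hl0.le, div_le_iff₀ (by positivity)] at hb
  have hxl : 0 ≤ x / l := by positivity
  have h2 : x ^ r ≤ (1 + x / l) * l ^ r := by
    refine hb.trans (mul_le_mul_of_nonneg_right ?_ (by positivity))
    nlinarith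
  have h3 : c * (x / l * l ^ r) ≤ x / 8 := by
    have : x / l * l ^ r = x / (8 * (c + 1)) := by
      rw [← hl1]
      nth_rewrite 1 [hl2]
      field_simp
    rw [this, ← mul_div_assoc, div_le_div_iff₀ (by positivity) (by positivity)]
    nlinarith
  calc c * x ^ r ≤ c * ((1 + x / l) * l ^ r) := mul_le_mul_of_nonneg_left h2 hc
    _ = c * (x / l * l ^ r) + c * l ^ r := by ring
    _ ≤ _ := by linarith

theorem sum_vertex_le [Fintype V] {N q : ℝ} (hq : 0 ≤ q) (u : GraphFun V B H)
    (h : ∀ v, |u.onVertex v| ≤ N) :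
    ∑ v, |u.onVertex v| ^ q ≤ Fintype.card V * N ^ q := by
  refine (Finset.sum_le_card_nsmul _ _ (N ^ q) fun v _ =>
    Real.rpow_le_rpow (abs_nonneg _) (h v) hq).trans ?_
  rw [nsmul_eq_mul, Finset.card_univ]

/-! ### Mass, energy and coercivity on the graph -/

variable [Fintype B] [Fintype H]

/-- `∫ |u'|²`. -/
noncomputable def kinetic (G : MetricGraph V B H) (u : GraphFun V B H) : ℝ :=
  ∑ i, ∫ x in G.arcDomain i, deriv (u.onArc i) x ^ 2

/-- `∫ |u|^p`. -/
noncomputable def potential (G : MetricGraph V B H) (p : ℝ) (u : GraphFun V B H) : ℝ :=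
  ∑ i, ∫ x in G.arcDomain i, |u.onArc i x| ^ p

theorem mass_eq (G : MetricGraph V B H) (u : GraphFun V B H) :
    G.mass u = ∑ i, ∫ x in G.arcDomain i, u.onArc i x ^ 2 := by
  simp only [mass, integral, Fintype.sum_sum_type, arcDomain, GraphFun.onArc, Sum.elim_inl,
    Sum.elim_inr, sq_abs]

theorem energy_eq [Fintype V] (G : MetricGraph V B H) (p q : ℝ) (u : GraphFun V B H) :
    G.energy p q u = 1 / 2 * G.kinetic u - 1 / p * G.potential p u
      - 1 / q * ∑ v, |u.onVertex v| ^ q := by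
  simp only [energy, integral, kinetic, potential, Fintype.sum_sum_type, arcDomain, GraphFun.onArc,
    Sum.elim_inl, Sum.elim_inr, sq_abs]

theorem kinetic_nonneg (G : MetricGraph V B H) (u : GraphFun V B H) : 0 ≤ G.kinetic u :=
  Finset.sum_nonneg fun _ _ => integral_nonneg fun _ => sq_nonneg _

theorem mass_nonneg (G : MetricGraph V B H) (u : GraphFun V B H) : 0 ≤ G.mass u := by
  rw [mass_eq]
  exact Finset.sum_nonneg fun _ _ => integral_nonneg fun _ => sq_nonneg _

theorem potential_nonneg (G : MetricGraph V B H) (p : ℝ) (u : GraphFun V B H) :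
    0 ≤ G.potential p u :=
  Finset.sum_nonneg fun _ _ => integral_nonneg fun _ => Real.rpow_nonneg (abs_nonneg _) _

theorem mass_smulFun (G : MetricGraph V B H) (t : ℝ) (u : GraphFun V B H) :
    G.mass (smulFun t u) = t ^ 2 * G.mass u := by
  simp only [mass_eq, smulFun_onArc, mul_pow, integral_const_mul, Finset.mul_sum]

/-- The kinetic term scales by `t²`, the two negative terms by `t ^ p` and `t ^ q`, both at least
`t²` since `t ≥ 1`. -/
theorem energy_smulFun_le [Fintype V] (G : MetricGraph V B H) {p q t : ℝ} (hp : 2 < p) (hq : 2 < q)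
    (ht : 1 ≤ t) (u : GraphFun V B H) :
    G.energy p q (smulFun t u) ≤ t ^ 2 * G.energy p q u := by
  have ht0 : 0 ≤ t := by linarith
  have hk : G.kinetic (smulFun t u) = t ^ 2 * G.kinetic u := by
    simp only [kinetic, deriv_smulFun_onArc, mul_pow, integral_const_mul, Finset.mul_sum]
  have hpow : ∀ r : ℝ, 2 < r → t ^ 2 ≤ t ^ r := fun r hr => by
    rw [← Real.rpow_two]; exact Real.rpow_le_rpow_of_exponent_le ht hr.le
  have hP : G.potential p (smulFun t u) = t ^ p * G.potential p u := by
    simp only [potential, smulFun_onArc, abs_mul, abs_of_nonneg ht0,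
      Real.mul_rpow ht0 (abs_nonneg _), integral_const_mul, Finset.mul_sum]
  have hV : ∑ v, |(smulFun t u).onVertex v| ^ q = t ^ q * ∑ v, |u.onVertex v| ^ q := by
    simp only [smulFun, abs_mul, abs_of_nonneg ht0, Real.mul_rpow ht0 (abs_nonneg _),
      Finset.mul_sum]
  have h1 := mul_le_mul_of_nonneg_right (hpow p hp) (G.potential_nonneg p u)
  have h2 := mul_le_mul_of_nonneg_right (hpow q hq)
    (show 0 ≤ ∑ v, |u.onVertex v| ^ q by positivity)
  rw [energy_eq, energy_eq, hk, hP, hV]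
  have h3 := mul_le_mul_of_nonneg_left h1 (show 0 ≤ 1 / p by positivity)
  have h4 := mul_le_mul_of_nonneg_left h2 (show 0 ≤ 1 / q by positivity)
  linarith

/-- Pointwise control by mass and kinetic energy. -/
theorem exists_sq_le (G : MetricGraph V B H) : ∃ c : ℝ, 0 < c ∧
    ∀ u : GraphFun V B H, G.MemH1 u → ∀ t : ℝ, 0 < t → ∀ (i : B ⊕ H) (x : ℝ), 0 ≤ x →
      Ioo 0 x ⊆ G.arcDomain i → u.onArc i x ^ 2 ≤ (c + t) * G.mass u + t⁻¹ * G.kinetic u := by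
  have hpos : ∀ e, 0 < (G.length e)⁻¹ := fun e => inv_pos.2 (G.length_pos e)
  have hsum : 0 ≤ ∑ e, (G.length e)⁻¹ := Finset.sum_nonneg fun e _ => (hpos e).le
  -- The constant dominates `ℓ⁻¹` for every bounded edge; the summand `1` serves the half-lines,
  -- where `ℓ = 1`.
  refine ⟨∑ e, (G.length e)⁻¹ + 1, by linarith, fun u hu t ht i x hx hxi => ?_⟩
  have hm : ∫ y in G.arcDomain i, u.onArc i y ^ 2 ≤ G.mass u := by
    rw [mass_eq]
    exact Finset.single_le_sum (f := fun i => ∫ y in G.arcDomain i, u.onArc i y ^ 2)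
      (fun _ _ => integral_nonneg fun _ => sq_nonneg _) (Finset.mem_univ i)
  have hk : ∫ y in G.arcDomain i, deriv (u.onArc i) y ^ 2 ≤ G.kinetic u :=
    Finset.single_le_sum (f := fun i => ∫ y in G.arcDomain i, deriv (u.onArc i) y ^ 2)
      (fun _ _ => integral_nonneg fun _ => sq_nonneg _) (Finset.mem_univ i)
  have hm0 : 0 ≤ ∫ y in G.arcDomain i, u.onArc i y ^ 2 := integral_nonneg fun _ => sq_nonneg _
  have key : ∃ ℓ : ℝ, 0 < ℓ ∧ Ioo 0 ℓ ⊆ G.arcDomain i ∧ ℓ⁻¹ ≤ ∑ e, (G.length e)⁻¹ + 1 := by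
    cases i with
    | inl e =>
      refine ⟨G.length e, G.length_pos e, le_rfl, ?_⟩
      have := Finset.single_le_sum (f := fun e => (G.length e)⁻¹) (fun e _ => (hpos e).le)
        (Finset.mem_univ e)
      linarith
    | inr h => exact ⟨1, one_pos, Ioo_subset_Ioi_self, by simpa using hsum⟩
  obtain ⟨ℓ, hℓ, hℓS, hle⟩ := key
  refine ((hu.edgeH1 i).sq_le hℓ hℓS ht hx hxi).trans ?_
  have hti : 0 ≤ t⁻¹ := by positivity
  have hlt : 0 ≤ ∑ e, (G.length e)⁻¹ + 1 + t := by positivity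
  gcongr

theorem potential_le {G : MetricGraph V B H} {u : GraphFun V B H} (hu : G.MemH1 u) {p N : ℝ}
    (hp : 2 < p)
    (h : ∀ (i : B ⊕ H) (x : ℝ), 0 ≤ x → Ioo 0 x ⊆ G.arcDomain i → |u.onArc i x| ≤ N) :
    G.potential p u ≤ N ^ (p - 2) * G.mass u := by
  rw [mass_eq, Finset.mul_sum]
  refine Finset.sum_le_sum fun i _ => ?_
  have hN : ∀ x ∈ G.arcDomain i, |u.onArc i x| ≤ N := fun x hx =>
    h i x (G.arcDomain_spec i x hx).1.le (G.arcDomain_spec i x hx).2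
  rw [← integral_const_mul]
  refine setIntegral_mono_on ((hu.edgeH1 i).integrableOn_rpow (G.measurableSet_arcDomain i) hp hN)
    ((hu.edgeH1 i).memLp.integrable_sq.const_mul _) (G.measurableSet_arcDomain i) fun x hx => ?_
  exact abs_rpow_le hp (hN x hx)

/-- Coercivity of the energy on functions of given mass. -/
theorem exists_kinetic_le [Fintype V] {G : MetricGraph V B H} (hH : G.AssumptionH) {p q m : ℝ} (hp : 2 < p)
    (hp' : p < 6) (hq : 2 < q) (hq' : q < 4) (hm : 0 ≤ m) :
    ∃ C : ℝ, ∀ u : GraphFun V B H, G.MemH1Mass m u →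
      G.kinetic u ≤ 4 * G.energy p q u + C := by
  obtain ⟨c, hc, hsq⟩ := G.exists_sq_le
  -- The pointwise bound with `t = √(K + 1)` gives `sup u² ≤ A * √(K + 1)`. Hence the potential and
  -- vertex terms grow like `K ^ ((p - 2) / 4)` and `K ^ (q / 4)`, sublinearly because `p < 6` and
  -- `q < 4`.
  set A := c * m + m + 1 with hA
  have hA0 : 0 ≤ A := by positivity
  obtain ⟨C₁, h₁⟩ := exists_mul_rpow_le (r := (p - 2) / 4) (c := A ^ ((p - 2) / 2) * m / p)
    (by linarith) (by linarith) (by positivity)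
  obtain ⟨C₂, h₂⟩ := exists_mul_rpow_le (r := q / 4) (c := Fintype.card V * A ^ (q / 2) / q)
    (by linarith) (by linarith) (by positivity)
  -- The energy is at least `K / 2 - 2 * (K + 1) / 8 - C₁ - C₂`; solve for `K`.
  refine ⟨4 * (C₁ + C₂ + 1 / 4), fun u hu => ?_⟩
  set K := G.kinetic u with hK
  have hK0 : 0 ≤ K := G.kinetic_nonneg u
  have hs : 0 < √(K + 1) := Real.sqrt_pos.2 (by linarith)
  have hs1 : 1 ≤ √(K + 1) := Real.one_le_sqrt.2 (by linarith)
  set N := √(A * √(K + 1)) with hN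
  have hb : ∀ (i : B ⊕ H) (x : ℝ), 0 ≤ x → Ioo 0 x ⊆ G.arcDomain i → |u.onArc i x| ≤ N := by
    intro i x hx hxi
    refine Real.abs_le_sqrt ((hsq u hu.1 _ hs i x hx hxi).trans ?_)
    rw [hu.2, ← hK]
    have : (√(K + 1))⁻¹ * K ≤ √(K + 1) := by
      rw [inv_mul_le_iff₀ hs, ← sq, Real.sq_sqrt (by linarith)]; linarith
    nlinarith [mul_nonneg hc.le hm]
  have hbV : ∀ v, |u.onVertex v| ≤ N := by
    intro v
    obtain ⟨i, x, hx, hxi, h⟩ := hH.exists_arc v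
    rw [h u hu.1]; exact hb i x hx hxi
  have hNr : ∀ r : ℝ, N ^ r = A ^ (r / 2) * (K + 1) ^ (r / 4) := by
    intro r
    rw [hN, Real.sqrt_eq_rpow, ← Real.rpow_mul (by positivity), Real.mul_rpow hA0 hs.le,
      Real.sqrt_eq_rpow, ← Real.rpow_mul (by positivity)]
    congr 2 <;> ring
  have hP := potential_le hu.1 hp hb
  have hV := sum_vertex_le (by linarith : 0 ≤ q) u hbV
  rw [hu.2, hNr] at hP
  rw [hNr] at hV
  have g₁ := h₁ (K + 1) (by linarith)
  have g₂ := h₂ (K + 1) (by linarith)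
  have hP' : 1 / p * G.potential p u ≤ (K + 1) / 8 + C₁ := by
    refine le_trans ?_ g₁
    refine (mul_le_mul_of_nonneg_left hP (by positivity)).trans (le_of_eq ?_)
    ring
  have hV' : 1 / q * ∑ v, |u.onVertex v| ^ q ≤ (K + 1) / 8 + C₂ := by
    refine le_trans ?_ g₂
    refine (mul_le_mul_of_nonneg_left hV (by positivity)).trans (le_of_eq ?_)
    ring
  rw [energy_eq]
  linarith

end MetricGraph

namespace MetricGraph
open Filter Topology

/-! ### Existence of ground states below the energy threshold of the line -/

variable {V B H : Type*}

/-- The lengths of the edges after all half-lines have been cut at `R`. -/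
def truncLength (G : MetricGraph V B H) (R : ℝ) : B ⊕ H → ℝ := Sum.elim G.length fun _ => R

theorem truncLength_nonneg (G : MetricGraph V B H) {R : ℝ} (hR : 0 ≤ R) (i : B ⊕ H) :
    0 ≤ G.truncLength R i := by
  cases i with
  | inl e => exact (G.length_pos e).le
  | inr h => exact hR

theorem Ioo_truncLength_subset (G : MetricGraph V B H) (R : ℝ) (i : B ⊕ H) :
    Ioo 0 (G.truncLength R i) ⊆ G.arcDomain i := by
  cases i with
  | inl e => exact le_rfl
  | inr h => exact Ioo_subset_Ioi_self

theorem setIntegral_Ioi_eq_add {f : ℝ → ℝ} (hf : IntegrableOn f (Ioi 0)) {R : ℝ} (hR : 0 ≤ R) :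
    ∫ x in Ioi 0, f x = (∫ x in Ioo 0 R, f x) + ∫ x in Ioi R, f x := by
  rw [← integral_Ioc_eq_integral_Ioo, ← Ioc_union_Ioi_eq_Ioi hR]
  exact setIntegral_union (Ioc_disjoint_Ioi le_rfl) measurableSet_Ioi
    (hf.mono_set Ioc_subset_Ioi_self) (hf.mono_set (Ioi_subset_Ioi hR))

theorem tendsto_setIntegral_Ioo {f : ℝ → ℝ} (hf : IntegrableOn f (Ioi 0)) :
    Tendsto (fun R : ℝ => ∫ x in Ioo 0 R, f x) atTop (𝓝 (∫ x in Ioi 0, f x)) := by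
  refine (intervalIntegral_tendsto_integral_Ioi 0 hf tendsto_id).congr' ?_
  filter_upwards [eventually_ge_atTop 0] with R hR
  rw [id, intervalIntegral.integral_of_le hR, integral_Ioc_eq_integral_Ioo]

variable [Fintype B] [Fintype H]

theorem sum_arcDomain_eq (G : MetricGraph V B H) {f : B ⊕ H → ℝ → ℝ}
    (hf : ∀ i, IntegrableOn (f i) (G.arcDomain i)) {R : ℝ} (hR : 0 ≤ R) :
    ∑ i, ∫ x in G.arcDomain i, f i x =
      (∑ i, ∫ x in Ioo 0 (G.truncLength R i), f i x) + ∑ h, ∫ x in Ioi R, f (.inr h) x := by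
  simp only [Fintype.sum_sum_type]
  rw [add_assoc, ← Finset.sum_add_distrib]
  congr 1
  exact Finset.sum_congr rfl fun h _ => setIntegral_Ioi_eq_add (hf (.inr h)) hR

theorem tendsto_sum_truncLength (G : MetricGraph V B H) {f : B ⊕ H → ℝ → ℝ}
    (hf : ∀ i, IntegrableOn (f i) (G.arcDomain i)) :
    Tendsto (fun R => ∑ i, ∫ x in Ioo 0 (G.truncLength R i), f i x) atTop
      (𝓝 (∑ i, ∫ x in G.arcDomain i, f i x)) := by
  refine tendsto_finsetSum _ fun i _ => ?_
  cases i with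
  | inl e => exact tendsto_const_nhds
  | inr h => exact tendsto_setIntegral_Ioo (hf (.inr h))

theorem MemH1.integrableOn_potential {G : MetricGraph V B H} {u : GraphFun V B H}
    (hu : G.MemH1 u) {p : ℝ} (hp : 2 < p) (i : B ⊕ H) :
    IntegrableOn (fun x => |u.onArc i x| ^ p) (G.arcDomain i) := by
  obtain ⟨c, -, hsq⟩ := G.exists_sq_le
  exact (hu.edgeH1 i).integrableOn_rpow (G.measurableSet_arcDomain i) hp fun x hx =>
    Real.abs_le_sqrt (hsq u hu 1 one_pos i x (G.arcDomain_spec i x hx).1.le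
      (G.arcDomain_spec i x hx).2)

/-- Lower bound for the energy: the far parts of the half-lines cost at least as much as on
the line. -/
theorem energy_ge_trunc [Fintype V] {G : MetricGraph V B H} {u : GraphFun V B H} {p q m N R : ℝ}
    (hu : G.MemH1Mass m u) (hp : 2 < p) (hp' : p < 6) (hm : 0 < m) (hR : 0 ≤ R)
    (hN : ∀ (i : B ⊕ H) (x : ℝ), 0 ≤ x → Ioo 0 x ⊆ G.arcDomain i → |u.onArc i x| ≤ N) :
    1 / 2 * (∑ i, ∫ x in Ioo 0 (G.truncLength R i), deriv (u.onArc i) x ^ 2)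
      - 1 / p * (∑ i, ∫ x in Ioo 0 (G.truncLength R i), |u.onArc i x| ^ p)
      - 1 / q * (∑ v, |u.onVertex v| ^ q)
      + (m - ∑ i, ∫ x in Ioo 0 (G.truncLength R i), |u.onArc i x| ^ (2 : ℝ)) / m * lineEnergy p m
      - √(2 / p * N ^ (p - 2)) * ((∑ h, u.onArc (.inr h) R ^ 2) / 2) ≤ G.energy p q u := by
  have k1 := G.sum_arcDomain_eq (fun i => (hu.1.edgeH1 i).deriv_memLp.integrable_sq) hR
  have k2 := G.sum_arcDomain_eq (fun i => (hu.1.edgeH1 i).memLp.integrable_sq) hR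
  have k3 := G.sum_arcDomain_eq (fun i => hu.1.integrableOn_potential hp i) hR
  simp only [Real.rpow_two, sq_abs]
  rw [energy_eq, kinetic, potential, k1, k3]
  have hmass := hu.2
  rw [mass_eq, k2] at hmass
  -- The mass missed by the truncation is that of the tails, so the linear tail bounds add up to the
  -- `lineEnergy` term.
  have hsum : m - ∑ i, ∫ x in Ioo 0 (G.truncLength R i), u.onArc i x ^ 2 =
      ∑ h, ∫ x in Ioi R, u.onArc (.inr h) x ^ 2 := by linarith
  rw [hsum]
  have h0 : ∀ h, 0 ≤ ∫ x in Ioi R, u.onArc (.inr h) x ^ 2 := fun h =>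
    integral_nonneg fun _ => sq_nonneg _
  have h0' : 0 ≤ ∑ i, ∫ x in Ioo 0 (G.truncLength R i), u.onArc i x ^ 2 :=
    Finset.sum_nonneg fun _ _ => integral_nonneg fun _ => sq_nonneg _
  have htail : ∀ h, (∫ x in Ioi R, u.onArc (.inr h) x ^ 2) / m * lineEnergy p m
      - √(2 / p * N ^ (p - 2)) * (u.onArc (.inr h) R ^ 2 / 2) ≤
      1 / 2 * (∫ x in Ioi R, deriv (u.onArc (.inr h)) x ^ 2)
        - 1 / p * ∫ x in Ioi R, |u.onArc (.inr h) x| ^ p := by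
    intro h
    refine energy_tail_ge hp hp' hm (hu.1.edgeH1 (.inr h)) hR
      (fun x hx => hN _ x hx Ioo_subset_Ioi_self) ?_
    have := Finset.single_le_sum (f := fun h => ∫ x in Ioi R, u.onArc (.inr h) x ^ 2)
      (fun h _ => h0 h) (Finset.mem_univ h)
    linarith
  have hs := Finset.sum_le_sum fun h (_ : h ∈ Finset.univ) => htail h
  simp only [Finset.sum_sub_distrib, ← Finset.mul_sum, ← Finset.sum_mul, ← Finset.sum_div] at hs
  linarith

/-- A convergent subsequence of a bounded sequence in `H¹`. -/
theorem exists_convergent_subseq [Fintype V] {G : MetricGraph V B H} {U : ℕ → GraphFun V B H}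
    (hU : ∀ k, G.MemH1 (U k)) {C N : ℝ} (hm : ∀ k, G.mass (U k) ≤ C)
    (hk : ∀ k, G.kinetic (U k) ≤ C)
    (hN : ∀ k (i : B ⊕ H) (x : ℝ), 0 ≤ x → Ioo 0 x ⊆ G.arcDomain i → |(U k).onArc i x| ≤ N)
    (hV : ∀ k v, |(U k).onVertex v| ≤ N) :
    ∃ φ : ℕ → ℕ, StrictMono φ ∧ ∃ u : GraphFun V B H, G.MemH1 u ∧
      (∀ v, Tendsto (fun k => (U (φ k)).onVertex v) atTop (𝓝 (u.onVertex v))) ∧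
      ∀ i, EdgeConv (G.arcDomain i) (fun k => (U (φ k)).onArc i) (u.onArc i) := by
  have hbdd : ∀ a : ℕ → ℝ, (∀ k, |a k| ≤ N) →
      ∃ (c : ℝ) (ψ : ℕ → ℕ), StrictMono ψ ∧ Tendsto (fun k => a (ψ k)) atTop (𝓝 c) := by
    intro a ha
    obtain ⟨c, -, ψ, hψ, hc⟩ := (isCompact_Icc (a := -N) (b := N)).tendsto_subseq
      (fun k => abs_le.1 (ha k))
    exact ⟨c, ψ, hψ, hc⟩
  -- One property per edge and one per vertex. The gluing conditions then pass to the limit by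
  -- uniqueness of limits.
  let P : (B ⊕ H) ⊕ V → (ℕ → ℕ) → Prop := Sum.elim
    (fun i φ => ∃ u, EdgeConv (G.arcDomain i) (fun k => (U (φ k)).onArc i) u)
    (fun v φ => ∃ c : ℝ, Tendsto (fun k => (U (φ k)).onVertex v) atTop (𝓝 c))
  obtain ⟨φ, hφ, hP⟩ := exists_common_subseq P (by
    rintro (i | v) φ ψ h hψ
    · obtain ⟨u, hu⟩ := h
      exact ⟨u, hu.comp hψ⟩
    · obtain ⟨c, hc⟩ := h
      exact ⟨c, hc.comp hψ.tendsto_atTop⟩) (by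
    rintro (i | v) φ hφ
    · obtain ⟨c, ψ, hψ, hc⟩ := hbdd (fun k => (U (φ k)).onArc i 0)
        (fun k => hN _ i 0 le_rfl (by simp))
      have h1 : ∀ k, ∫ y in G.arcDomain i, (U k).onArc i y ^ 2 ≤ C := fun k => by
        refine le_trans ?_ (hm k)
        rw [mass_eq]
        exact Finset.single_le_sum (f := fun i => ∫ y in G.arcDomain i, (U k).onArc i y ^ 2)
          (fun _ _ => integral_nonneg fun _ => sq_nonneg _) (Finset.mem_univ i)
      have h2 : ∀ k, ∫ y in G.arcDomain i, deriv ((U k).onArc i) y ^ 2 ≤ C := fun k =>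
        (Finset.single_le_sum (f := fun i => ∫ y in G.arcDomain i, deriv ((U k).onArc i) y ^ 2)
          (fun _ _ => integral_nonneg fun _ => sq_nonneg _) (Finset.mem_univ i)).trans (hk k)
      obtain ⟨χ, hχ, u, hu⟩ := exists_edgeConv (G.measurableSet_arcDomain i) (G.arcDomain_spec i)
        (fun k => (hU (φ (ψ k))).edgeH1 i) (fun k => h1 _) (fun k => h2 _) hc
      exact ⟨ψ ∘ χ, hψ.comp hχ, u, hu⟩
    · obtain ⟨c, ψ, hψ, hc⟩ := hbdd (fun k => (U (φ k)).onVertex v) (fun k => hV _ v)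
      exact ⟨ψ, hψ, c, hc⟩)
  choose w hw using fun i => hP (.inl i)
  choose c hc using fun v => hP (.inr v)
  have harc : ∀ i, (GraphFun.mk c (fun e => w (.inl e)) fun h => w (.inr h)).onArc i = w i := by
    rintro (e | h) <;> rfl
  refine ⟨φ, hφ, ⟨c, fun e => w (.inl e), fun h => w (.inr h)⟩, .of_edgeH1 (fun i => ?_)
    (fun e => ?_) (fun e => ?_) (fun h => ?_), hc, fun i => ?_⟩
  · rw [harc]; exact (hw i).edgeH1
  · refine tendsto_nhds_unique ((hw (.inl e)).tendsto 0 le_rfl (by simp)) ((hc (G.src e)).congr ?_)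
    exact fun k => ((hU (φ k)).edge_src e).symm
  · refine tendsto_nhds_unique ((hw (.inl e)).tendsto _ (G.length_pos e).le le_rfl)
      ((hc (G.tgt e)).congr ?_)
    exact fun k => ((hU (φ k)).edge_tgt e).symm
  · refine tendsto_nhds_unique ((hw (.inr h)).tendsto 0 le_rfl (by simp))
      ((hc (G.base h)).congr ?_)
    exact fun k => ((hU (φ k)).half_base h).symm
  · rw [harc]; exact hw i

/-- The energy of a limit of functions of mass `m`: the mass that is lost carries at least the
energy of solitons on the line. -/
theorem limit_energy_le [Fintype V] {G : MetricGraph V B H} {U : ℕ → GraphFun V B H}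
    {u : GraphFun V B H} {p q m N I : ℝ} (hp : 2 < p) (hp' : p < 6) (hq : 2 < q) (hm : 0 < m)
    (hU : ∀ k, G.MemH1Mass m (U k)) (hu : G.MemH1 u)
    (hN : ∀ k (i : B ⊕ H) (x : ℝ), 0 ≤ x → Ioo 0 x ⊆ G.arcDomain i → |(U k).onArc i x| ≤ N)
    (hV : ∀ v, Tendsto (fun k => (U k).onVertex v) atTop (𝓝 (u.onVertex v)))
    (hE : ∀ i, EdgeConv (G.arcDomain i) (fun k => (U k).onArc i) (u.onArc i))
    (hI : Tendsto (fun k => G.energy p q (U k)) atTop (𝓝 I)) :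
    G.mass u ≤ m ∧ G.energy p q u + (m - G.mass u) / m * lineEnergy p m ≤ I := by
  have hint : ∀ r : ℝ, 0 ≤ r → ∀ R : ℝ, Tendsto
      (fun k => ∑ i, ∫ x in Ioo 0 (G.truncLength R i), |(U k).onArc i x| ^ r) atTop
      (𝓝 (∑ i, ∫ x in Ioo 0 (G.truncLength R i), |u.onArc i x| ^ r)) := fun r hr R =>
    tendsto_finsetSum _ fun i _ => (hE i).tendsto_integral (fun k => (hU k).1.edgeH1 i)
      (fun k => hN k i) (G.Ioo_truncLength_subset R i) hr
  have htrunc : ∀ R, 0 ≤ R → ∀ k,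
      ∑ i, ∫ x in Ioo 0 (G.truncLength R i), |(U k).onArc i x| ^ (2 : ℝ) ≤ m := by
    intro R hR k
    rw [← (hU k).2, mass_eq]
    simp only [Real.rpow_two, sq_abs]
    exact Finset.sum_le_sum fun i _ => setIntegral_mono_set
      ((hU k).1.edgeH1 i).memLp.integrable_sq (Eventually.of_forall fun _ => sq_nonneg _)
      (Eventually.of_forall (G.Ioo_truncLength_subset R i))
  have hmass_lim : Tendsto
      (fun R => ∑ i, ∫ x in Ioo 0 (G.truncLength R i), |u.onArc i x| ^ (2 : ℝ)) atTop
      (𝓝 (G.mass u)) := by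
    rw [mass_eq]
    simp only [Real.rpow_two, sq_abs]
    exact G.tendsto_sum_truncLength fun i => (hu.edgeH1 i).memLp.integrable_sq
  have hkin_lim : Tendsto
      (fun R => ∑ i, ∫ x in Ioo 0 (G.truncLength R i), deriv (u.onArc i) x ^ 2) atTop
      (𝓝 (G.kinetic u)) :=
    G.tendsto_sum_truncLength fun i => (hu.edgeH1 i).deriv_memLp.integrable_sq
  have hpot_lim : Tendsto
      (fun R => ∑ i, ∫ x in Ioo 0 (G.truncLength R i), |u.onArc i x| ^ p) atTop
      (𝓝 (G.potential p u)) :=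
    G.tendsto_sum_truncLength fun i => hu.integrableOn_potential hp i
  refine ⟨le_of_tendsto hmass_lim ?_, ?_⟩
  · filter_upwards [eventually_ge_atTop 0] with R hR
    exact le_of_tendsto (hint 2 zero_le_two R) (Eventually.of_forall (htrunc R hR))
  set c := √(2 / p * N ^ (p - 2))
  have hvert : Tendsto (fun k => ∑ v, |(U k).onVertex v| ^ q) atTop
      (𝓝 (∑ v, |u.onVertex v| ^ q)) :=
    tendsto_finsetSum _ fun v _ => ((Real.continuous_rpow_const (by linarith)).comp
      continuous_abs).continuousAt.tendsto.comp (hV v)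
  -- First `k → ∞` with `R` fixed: on the truncated graph the mass and potential terms converge and
  -- the kinetic term is lower semicontinuous. Only afterwards `R → ∞`.
  have hfixed : ∀ R, 0 ≤ R →
      1 / 2 * (∑ i, ∫ x in Ioo 0 (G.truncLength R i), deriv (u.onArc i) x ^ 2)
      - 1 / p * (∑ i, ∫ x in Ioo 0 (G.truncLength R i), |u.onArc i x| ^ p)
      - 1 / q * (∑ v, |u.onVertex v| ^ q)
      + (m - ∑ i, ∫ x in Ioo 0 (G.truncLength R i), |u.onArc i x| ^ (2 : ℝ)) / m * lineEnergy p m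
      - c * ((∑ h, u.onArc (.inr h) R ^ 2) / 2) ≤ I := by
    intro R hR
    refine le_of_forall_pos_le_add fun ε hε => ?_
    -- The error is shared among all edges; the `+ 1` avoids division by zero.
    set δ := ε / (Fintype.card (B ⊕ H) + 1) with hδ
    have hδ0 : 0 < δ := by positivity
    have hlsc : ∀ᶠ k in atTop, ∀ i, (∫ x in Ioo 0 (G.truncLength R i), deriv (u.onArc i) x ^ 2) - δ
        ≤ ∫ x in Ioo 0 (G.truncLength R i), deriv ((U k).onArc i) x ^ 2 :=
      eventually_all.2 fun i => (hE i).lsc _ (G.truncLength_nonneg hR i)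
        (G.Ioo_truncLength_subset R i) δ hδ0
    have hend : Tendsto (fun k => ∑ h, (U k).onArc (.inr h) R ^ 2) atTop
        (𝓝 (∑ h, u.onArc (.inr h) R ^ 2)) :=
      tendsto_finsetSum _ fun h _ => ((hE (.inr h)).tendsto R hR Ioo_subset_Ioi_self).pow 2
    have L1 := ((((hint p (by linarith) R).const_mul (1 / p)).const_sub
      (1 / 2 * ((∑ i, ∫ x in Ioo 0 (G.truncLength R i), deriv (u.onArc i) x ^ 2) - ε))).sub
      (hvert.const_mul (1 / q))).add
      ((((hint 2 zero_le_two R).const_sub m).div_const m).mul_const (lineEnergy p m))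
    have L2 := L1.sub ((hend.div_const 2).const_mul c)
    have := le_of_tendsto_of_tendsto L2 hI ?_
    · linarith
    filter_upwards [hlsc] with k hk
    refine le_trans ?_ (energy_ge_trunc (hU k) hp hp' hm hR (hN k))
    have hs := Finset.sum_le_sum fun i (_ : i ∈ Finset.univ) => hk i
    rw [Finset.sum_sub_distrib, Finset.sum_const, nsmul_eq_mul, Finset.card_univ] at hs
    have hε' : (Fintype.card (B ⊕ H) : ℝ) * δ ≤ ε := by
      rw [hδ, ← mul_div_assoc, div_le_iff₀ (by positivity)]
      nlinarith
    gcongr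
    linarith
  -- The cutting error at the points `R` vanishes because `u` decays along the half-lines.
  have hzero : Tendsto (fun R => ∑ h, u.onArc (.inr h) R ^ 2) atTop (𝓝 (∑ _h : H, 0 ^ 2)) :=
    tendsto_finsetSum _ fun h _ => ((hu.edgeH1 (.inr h)).tendsto_zero).pow 2
  have hL := (((hkin_lim.const_mul (1 / 2)).sub (hpot_lim.const_mul (1 / p))).sub
    (tendsto_const_nhds (x := 1 / q * ∑ v, |u.onVertex v| ^ q))).add
    (((hmass_lim.const_sub m).div_const m).mul_const (lineEnergy p m))
  have hL2 := hL.sub ((hzero.div_const 2).const_mul c)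
  have := le_of_tendsto hL2 (by filter_upwards [eventually_ge_atTop 0] with R hR using hfixed R hR)
  rw [energy_eq]
  simpa using this

/-- A function of mass zero has nonnegative energy. -/
theorem energy_nonneg_of_mass_eq_zero [Fintype V] {G : MetricGraph V B H} (hH : G.AssumptionH)
    {u : GraphFun V B H} {p q : ℝ} (hp : 2 < p) (hq : 2 < q) (hu : G.MemH1 u)
    (h0 : G.mass u = 0) : 0 ≤ G.energy p q u := by
  obtain ⟨c, -, hsq⟩ := G.exists_sq_le
  have hz : ∀ (i : B ⊕ H) (x : ℝ), 0 ≤ x → Ioo 0 x ⊆ G.arcDomain i → |u.onArc i x| ≤ 0 := by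
    intro i x hx hxi
    -- With zero mass the pointwise bound is `t⁻¹` times the kinetic energy for every `t > 0`, so
    -- `u` vanishes.
    have hlim : Tendsto (fun t : ℝ => t⁻¹ * G.kinetic u) atTop (𝓝 (0 * G.kinetic u)) :=
      tendsto_inv_atTop_zero.mul_const _
    rw [zero_mul] at hlim
    have := ge_of_tendsto (b := u.onArc i x ^ 2) hlim (by
      filter_upwards [eventually_gt_atTop 0] with t ht
      simpa [h0] using hsq u hu t ht i x hx hxi)
    have : u.onArc i x = 0 := by nlinarith [sq_nonneg (u.onArc i x)]
    simp [this]
  have hV : ∀ v, |u.onVertex v| ≤ 0 := fun v => by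
    obtain ⟨i, x, hx, hxi, h⟩ := hH.exists_arc v
    rw [h u hu]; exact hz i x hx hxi
  have h1 := potential_le hu hp hz
  have h2 := sum_vertex_le (by linarith : 0 ≤ q) u hV
  rw [h0, mul_zero] at h1
  rw [Real.zero_rpow (by linarith), mul_zero] at h2
  have h3 := mul_le_mul_of_nonneg_left h1 (show 0 ≤ 1 / p by positivity)
  have h4 := mul_le_mul_of_nonneg_left h2 (show 0 ≤ 1 / q by positivity)
  have h5 := G.kinetic_nonneg u
  rw [energy_eq]
  linarith

/-- The direct method. If the limit `u` had mass below `m`, scaling would give `E(u) ≥ (mass u / m)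
* I`, while each unit of lost mass costs strictly more than `I / m`; the total would exceed `I`. -/
theorem exists_isGroundState_of_lt [Fintype V] {G : MetricGraph V B H} (hH : G.AssumptionH)
    {p q m : ℝ} (hp : 2 < p) (hp' : p < 6) (hq : 2 < q) (hq' : q < 4) (hm : 0 < m)
    {w : GraphFun V B H} (hw : G.MemH1 w) (hwm : G.mass w ≤ m)
    (hlt : G.energy p q w < lineEnergy p m) : ∃ u, G.IsGroundState p q m u := by
  have hneg := lineEnergy_neg hp hp' hm
  have hresc : ∀ u : GraphFun V B H, G.MemH1 u → 0 < G.mass u → G.mass u ≤ m →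
      ∃ u', G.MemH1Mass m u' ∧ G.energy p q u' ≤ m / G.mass u * G.energy p q u := by
    intro u hu h0 hle
    have ht : 1 ≤ √(m / G.mass u) := Real.one_le_sqrt.2 ((one_le_div h0).2 hle)
    have hts : √(m / G.mass u) ^ 2 = m / G.mass u := Real.sq_sqrt (by positivity)
    refine ⟨smulFun √(m / G.mass u) u, ⟨hu.smulFun _, ?_⟩, ?_⟩
    · rw [mass_smulFun, hts, div_mul_cancel₀ _ h0.ne']
    · have h := G.energy_smulFun_le hp hq ht u
      rwa [hts] at h
  have hw0 : 0 < G.mass w := by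
    refine lt_of_le_of_ne (G.mass_nonneg w) fun h => ?_
    have := energy_nonneg_of_mass_eq_zero (p := p) (q := q) hH hp hq hw h.symm
    linarith
  obtain ⟨w', hw', hww⟩ := hresc w hw hw0 hwm
  -- The energy of `w` is negative, so the factor `m / G.mass w ≥ 1` only lowers it.
  have hlt' : G.energy p q w' < lineEnergy p m := by
    have : 1 ≤ m / G.mass w := (one_le_div hw0).2 hwm
    nlinarith
  obtain ⟨C, hC⟩ := exists_kinetic_le hH hp hp' hq hq' hm.le
  set E := G.energy p q '' {u | G.MemH1Mass m u} with hE
  have hEne : E.Nonempty := ⟨_, w', hw', rfl⟩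
  have hEb : BddBelow E := by
    refine ⟨-C / 4, ?_⟩
    rintro _ ⟨u, hu, rfl⟩
    have := hC u hu
    have := G.kinetic_nonneg u
    linarith
  set I := sInf E with hI
  have hIle : ∀ u, G.MemH1Mass m u → I ≤ G.energy p q u := fun u hu => csInf_le hEb ⟨u, hu, rfl⟩
  obtain ⟨a, -, ha, haE⟩ := exists_seq_tendsto_sInf hEne hEb
  choose U hU hUa using haE
  obtain ⟨b, hb⟩ := ha.bddAbove_range
  set K := max m (4 * b + C) with hK
  have hkin : ∀ k, G.kinetic (U k) ≤ K := fun k => by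
    have h1 := hC (U k) (hU k)
    have h2 : a k ≤ b := hb ⟨k, rfl⟩
    rw [hUa] at h1
    exact le_max_of_le_right (by linarith)
  have hmassU : ∀ k, G.mass (U k) ≤ K := fun k => by rw [(hU k).2]; exact le_max_left _ _
  obtain ⟨c, hc, hsq⟩ := G.exists_sq_le
  have hN : ∀ k (i : B ⊕ H) (x : ℝ), 0 ≤ x → Ioo 0 x ⊆ G.arcDomain i →
      |(U k).onArc i x| ≤ √((c + 1) * K + K) := by
    intro k i x hx hxi
    refine Real.abs_le_sqrt ((hsq _ (hU k).1 1 one_pos i x hx hxi).trans ?_)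
    have := hkin k
    have := hmassU k
    rw [inv_one, one_mul]
    gcongr
  have hNV : ∀ k v, |(U k).onVertex v| ≤ √((c + 1) * K + K) := by
    intro k v
    obtain ⟨i, x, hx, hxi, h⟩ := hH.exists_arc v
    rw [h _ (hU k).1]; exact hN k i x hx hxi
  obtain ⟨φ, hφ, u, hu, hV, hconv⟩ :=
    exists_convergent_subseq (fun k => (hU k).1) hmassU hkin hN hNV
  have hlimI : Tendsto (fun k => G.energy p q (U (φ k))) atTop (𝓝 I) := by
    simp only [hUa]; exact ha.comp hφ.tendsto_atTop
  obtain ⟨hum, hue⟩ := limit_energy_le hp hp' hq hm (fun k => hU (φ k)) hu (fun k => hN (φ k))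
    hV hconv hlimI
  rcases hum.eq_or_lt with heq | hltm
  · refine ⟨u, ⟨hu, heq⟩, fun z hz => ?_⟩
    rw [heq, sub_self, zero_div, zero_mul, add_zero] at hue
    exact hue.trans (hIle z hz)
  · exfalso
    have hs : G.mass u / m * I ≤ G.energy p q u := by
      rcases (G.mass_nonneg u).eq_or_lt with h0 | h0
      · rw [← h0, zero_div, zero_mul]
        exact energy_nonneg_of_mass_eq_zero hH hp hq hu h0.symm
      · obtain ⟨u', hu', hle⟩ := hresc u hu h0 hum
        have h1 := (hIle u' hu').trans hle
        calc G.mass u / m * I ≤ G.mass u / m * (m / G.mass u * G.energy p q u) :=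
              mul_le_mul_of_nonneg_left h1 (by positivity)
          _ = G.energy p q u := by field_simp
    have hIe : I < lineEnergy p m := (hIle w' hw').trans_lt hlt'
    have hpos : 0 < (m - G.mass u) / m := div_pos (by linarith) hm
    have h2 := mul_lt_mul_of_pos_left hIe hpos
    have h3 : G.mass u / m * I + (m - G.mass u) / m * I = I := by field_simp; ring
    linarith

end MetricGraph

namespace MetricGraph
open Filter Topology

/-! ### Small masses -/

variable {V B H : Type*}

theorem absolutelyContinuousOnInterval_of_contDiff {f : ℝ → ℝ} (hf : ContDiff ℝ 1 f) (a b : ℝ) :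
    AbsolutelyContinuousOnInterval f a b :=
  hf.contDiffOn.absolutelyContinuousOnInterval

theorem integral_sq_exp {a l : ℝ} (hl : 0 < l) :
    IntegrableOn (fun x => (a * Real.exp (-l * x)) ^ 2) (Ioi 0) ∧
      ∫ x in Ioi (0 : ℝ), (a * Real.exp (-l * x)) ^ 2 = a ^ 2 / (2 * l) := by
  have e : ∀ x : ℝ, (a * Real.exp (-l * x)) ^ 2 = a ^ 2 * Real.exp (-(2 * l) * x) := by
    intro x
    rw [mul_pow, ← Real.exp_nat_mul]
    congr 2; push_cast; ring
  simp only [e]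
  have h2 : -(2 * l) < 0 := by linarith
  refine ⟨(integrableOn_exp_mul_Ioi h2 0).const_mul _, ?_⟩
  rw [integral_const_mul, integral_exp_mul_Ioi h2]
  simp
  field_simp

theorem edgeH1_exp (a : ℝ) {l : ℝ} (hl : 0 < l) :
    EdgeH1 (Ioi 0) (fun x => a * Real.exp (-l * x)) := by
  have hd : deriv (fun x : ℝ => a * Real.exp (-l * x)) = fun x => (-l * a) * Real.exp (-l * x) := by
    ext x
    have : HasDerivAt (fun x : ℝ => a * Real.exp (-l * x)) (a * (Real.exp (-l * x) * (-l * 1))) x :=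
      (((hasDerivAt_id x).const_mul (-l)).exp).const_mul a
    rw [this.deriv]; ring
  refine ⟨fun T _ _ => absolutelyContinuousOnInterval_of_contDiff (by fun_prop) _ _, ?_, ?_⟩
  · exact (memLp_two_iff_integrable_sq (by fun_prop)).2 (integral_sq_exp hl).1
  · rw [hd]
    exact (memLp_two_iff_integrable_sq (by fun_prop)).2 (integral_sq_exp hl).1

theorem integral_deriv_sq_exp (a : ℝ) {l : ℝ} (hl : 0 < l) :
    ∫ x in Ioi (0 : ℝ), deriv (fun x : ℝ => a * Real.exp (-l * x)) x ^ 2 = a ^ 2 * l / 2 := by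
  have hd : deriv (fun x : ℝ => a * Real.exp (-l * x)) = fun x => (-l * a) * Real.exp (-l * x) := by
    ext x
    have : HasDerivAt (fun x : ℝ => a * Real.exp (-l * x)) (a * (Real.exp (-l * x) * (-l * 1))) x :=
      (((hasDerivAt_id x).const_mul (-l)).exp).const_mul a
    rw [this.deriv]; ring
  rw [hd, (integral_sq_exp hl).2]
  field_simp

/-- The function that is constant on the compact core and decays exponentially on the half-lines. -/
noncomputable def expFun (a l : ℝ) : GraphFun V B H where
  onVertex _ := a
  onEdge _ _ := a
  onHalf _ x := a * Real.exp (-l * x)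

theorem memH1_expFun (G : MetricGraph V B H) (a : ℝ) {l : ℝ} (hl : 0 < l) :
    G.MemH1 (expFun a l) := by
  refine .of_edgeH1 (fun i => ?_) (fun _ => rfl) (fun _ => rfl) fun _ => by simp [expFun]
  cases i with
  | inl e =>
    refine ⟨fun T _ _ => absolutelyContinuousOnInterval_of_contDiff contDiff_const _ _, ?_, ?_⟩
    · have : IsFiniteMeasure (volume.restrict (G.arcDomain (.inl e) : Set ℝ)) :=
        inferInstanceAs (IsFiniteMeasure (volume.restrict (Ioo 0 (G.length e))))
      exact memLp_const a
    · have : deriv ((expFun a l : GraphFun V B H).onArc (.inl e)) = 0 := by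
        ext x; exact deriv_const x a
      rw [this]; exact MemLp.zero
  | inr h => exact edgeH1_exp a hl

variable [Fintype B] [Fintype H]

theorem mass_expFun (G : MetricGraph V B H) (a : ℝ) {l : ℝ} (hl : 0 < l) :
    G.mass (expFun a l) = a ^ 2 * ∑ e, G.length e + Fintype.card H * (a ^ 2 / (2 * l)) := by
  rw [mass_eq, Fintype.sum_sum_type, Finset.mul_sum]
  congr 1
  · refine Finset.sum_congr rfl fun e _ => ?_
    simp [arcDomain, GraphFun.onArc, expFun, (G.length_pos e).le, mul_comm]
  · simp only [arcDomain, GraphFun.onArc, expFun, Sum.elim_inr, (integral_sq_exp hl).2]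
    simp

theorem kinetic_expFun (G : MetricGraph V B H) (a : ℝ) {l : ℝ} (hl : 0 < l) :
    G.kinetic (expFun a l) = Fintype.card H * (a ^ 2 * l / 2) := by
  rw [kinetic, Fintype.sum_sum_type]
  have : ∀ e, deriv ((expFun a l : GraphFun V B H).onArc (.inl e)) = 0 := fun e => by
    ext x; exact deriv_const x a
  simp only [this]
  simp only [arcDomain, GraphFun.onArc, expFun, Sum.elim_inr, integral_deriv_sq_exp a hl]
  simp

/-- The potential energy and all vertex terms but one are discarded; a single vertex term suffices.
-/
theorem energy_expFun_le [Fintype V] [Nonempty V] (G : MetricGraph V B H) {p q a l : ℝ}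
    (hp : 0 < p) (hq : 0 < q) (ha : 0 ≤ a) (hl : 0 < l) :
    G.energy p q (expFun a l) ≤ Fintype.card H * (a ^ 2 * l / 4) - a ^ q / q := by
  rw [energy_eq, kinetic_expFun G a hl]
  have h1 := mul_nonneg (one_div_pos.2 hp).le (G.potential_nonneg p (expFun a l))
  have h2 : a ^ q ≤ ∑ v : V, |(expFun a l : GraphFun V B H).onVertex v| ^ q := by
    simp only [expFun, abs_of_nonneg ha, Finset.sum_const, nsmul_eq_mul]
    have : (1 : ℝ) ≤ Fintype.card V := by exact_mod_cast Fintype.card_pos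
    rw [Finset.card_univ]
    exact le_mul_of_one_le_left (Real.rpow_nonneg ha _) this
  have h3 := mul_le_mul_of_nonneg_left h2 (one_div_pos.2 hq).le
  rw [one_div_mul_eq_div] at h3
  linarith

theorem eventually_mul_rpow_lt {r s C D : ℝ} (hsr : s < r) (hD : 0 < D) :
    ∀ᶠ m : ℝ in 𝓝[>] 0, C * m ^ r < D * m ^ s := by
  have h : Tendsto (fun m : ℝ => C * m ^ (r - s)) (𝓝[>] 0) (𝓝 (C * 0 ^ (r - s))) :=
    ((Real.continuousAt_rpow_const 0 (r - s) (Or.inr (by linarith))).tendsto.mono_left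
      nhdsWithin_le_nhds).const_mul C
  rw [Real.zero_rpow (by linarith), mul_zero] at h
  filter_upwards [h.eventually (gt_mem_nhds hD), self_mem_nhdsWithin] with m hm hm0
  have hm0' : (0 : ℝ) < m := hm0
  have : m ^ r = m ^ (r - s) * m ^ s := by rw [← Real.rpow_add hm0']; congr 1; ring
  rw [this, ← mul_assoc]
  exact mul_lt_mul_of_pos_right hm (by positivity)

/-- For small masses there are functions whose energy is below the threshold. -/
theorem eventually_exists_energy_lt_of_small [Fintype V] [Nonempty V] [Nonempty H]
    (G : MetricGraph V B H) {p q : ℝ} (hp : 2 < p) (hp' : p < 6) (hq : 2 < q)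
    (hpq : q < p / 2 + 1) :
    ∀ᶠ m : ℝ in 𝓝[>] 0, ∃ w : GraphFun V B H, G.MemH1 w ∧ G.mass w ≤ m ∧
      G.energy p q w < lineEnergy p m := by
  set n : ℝ := ((Fintype.card H : ℕ) : ℝ) with hn
  have hn0 : 0 < n := by rw [hn]; exact_mod_cast Fintype.card_pos
  set L := ∑ e, G.length e with hL
  have hL0 : 0 ≤ L := Finset.sum_nonneg fun e _ => (G.length_pos e).le
  -- With decay rate `l = n * a ^ 2 / m` the tails carry mass `m / 2` and contribute `n ^ 2 * a ^ 4
  -- / (4 * m)` to the energy. Setting `a ^ (4 - q) = c * m` makes this half of the vertex term `a ^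
  -- q / q`.
  set c := 2 / (q * n ^ 2) with hc
  have hc0 : 0 < c := by positivity
  have h4 : 0 < 4 - q := by linarith
  have h6 : 0 < 6 - p := by linarith
  have h2 : 0 < p - 2 := by linarith
  have hJ := lineConst_pos hp
  set κ := (6 - p) / (p - 2) * lineConst p with hκ
  set k := (p - 2) / (p * lineConst p * (p + 2)) with hk
  have hk0 : 0 < k := by positivity
  -- Equivalent to `q < p / 2 + 1`: the vertex gain has the smaller exponent and dominates as `m →
  -- 0`.
  have hexp : q / (4 - q) < 2 / (6 - p) * ((p + 2) / 2) := by
    rw [div_mul_div_comm, mul_comm 2 (p + 2), mul_div_mul_right _ _ (two_ne_zero),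
      div_lt_div_iff₀ h4 h6]
    nlinarith
  have ev1 := eventually_mul_rpow_lt (C := κ * k ^ (2 / (6 - p) * ((p + 2) / 2)))
    (D := c ^ (q / (4 - q)) / (2 * q)) hexp (by positivity)
  -- The core has mass `a ^ 2 * L`, of order `m ^ (2 / (4 - q))`. As `q > 2`, this exponent exceeds
  -- `1`, so the core fits into the remaining `m / 2`.
  have ev2 := eventually_mul_rpow_lt (C := L * c ^ (2 / (4 - q))) (D := 1 / 2) (s := 1)
    (r := 2 / (4 - q)) (by rw [lt_div_iff₀ h4]; linarith) (by norm_num)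
  filter_upwards [ev1, ev2, self_mem_nhdsWithin] with m hm1 hm2 hm0
  have hm : (0 : ℝ) < m := hm0
  set a := (c * m) ^ (1 / (4 - q)) with ha
  have ha0 : 0 < a := by positivity
  have hl : 0 < n * a ^ 2 / m := by positivity
  have har : ∀ r : ℝ, a ^ r = c ^ (r / (4 - q)) * m ^ (r / (4 - q)) := by
    intro r
    rw [ha, ← Real.rpow_mul (by positivity), ← Real.mul_rpow hc0.le hm.le]
    congr 1; ring
  have ha4 : a ^ 4 = c * m * a ^ q := by
    have h1 : a ^ (4 - q) = c * m := by
      rw [ha, ← Real.rpow_mul (by positivity), one_div_mul_cancel h4.ne', Real.rpow_one]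
    rw [← h1, ← Real.rpow_add ha0, ← Real.rpow_natCast]
    congr 1; push_cast; ring
  refine ⟨expFun a (n * a ^ 2 / m), G.memH1_expFun a hl, ?_, ?_⟩
  · rw [mass_expFun G a hl, ← hn, ← hL]
    have h1 : n * (a ^ 2 / (2 * (n * a ^ 2 / m))) = m / 2 := by field_simp
    have h3 : a ^ 2 * L ≤ m / 2 := by
      rw [← Real.rpow_two, har, mul_comm, ← mul_assoc]
      rw [Real.rpow_one] at hm2
      linarith
    linarith
  · refine (G.energy_expFun_le (by linarith) (by linarith) ha0.le hl).trans_lt ?_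
    rw [← hn, lineEnergy_eq hp hp' hm, solitonHeight]
    have h1 : n * (a ^ 2 * (n * a ^ 2 / m) / 4) - a ^ q / q = -(a ^ q / (2 * q)) := by
      have : n * (a ^ 2 * (n * a ^ 2 / m) / 4) = n ^ 2 * a ^ 4 / (4 * m) := by field_simp
      rw [this, ha4, hc]; field_simp; norm_num
    have h3 : (p - 2) * m / (p * lineConst p * (p + 2)) = k * m := by rw [hk]; ring
    rw [h1, h3, neg_lt_neg_iff, har, ← Real.rpow_mul (by positivity), Real.mul_rpow hk0.le hm.le,
      ← hκ]
    calc _ = κ * k ^ (2 / (6 - p) * ((p + 2) / 2)) * m ^ (2 / (6 - p) * ((p + 2) / 2)) := by ring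
      _ < _ := hm1
      _ = _ := by ring

end MetricGraph

namespace MetricGraph
open Filter Topology

/-! ### The soliton -/

/-- The exponential decay rate of the soliton of height `M`. -/
noncomputable def solitonRate (p M : ℝ) : ℝ := √(2 / p * M ^ (p - 2))

/-- The soliton of height `M`. -/
noncomputable def soliton (p M x : ℝ) : ℝ :=
  M * Real.cosh ((p - 2) / 2 * solitonRate p M * x) ^ (-(2 / (p - 2)))

theorem solitonRate_pos {p M : ℝ} (hp : 2 < p) (hM : 0 < M) : 0 < solitonRate p M := by
  unfold solitonRate; positivity

theorem solitonRate_sq {p M : ℝ} (hp : 2 < p) (hM : 0 < M) :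
    solitonRate p M ^ 2 = 2 / p * M ^ (p - 2) := Real.sq_sqrt (by positivity)

theorem soliton_pos {p M : ℝ} (hM : 0 < M) (x : ℝ) : 0 < soliton p M x := by
  unfold soliton
  have := Real.cosh_pos ((p - 2) / 2 * solitonRate p M * x)
  positivity

theorem soliton_le {p M : ℝ} (hp : 2 < p) (hM : 0 < M) (x : ℝ) : soliton p M x ≤ M := by
  have h2 : 0 < p - 2 := by linarith
  refine mul_le_of_le_one_right hM.le (Real.rpow_le_one_of_one_le_of_nonpos (Real.one_le_cosh _) ?_)
  rw [neg_nonpos]; positivity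

theorem soliton_zero (p M : ℝ) : soliton p M 0 = M := by simp [soliton]

theorem hasDerivAt_soliton {p M : ℝ} (hp : 2 < p) (x : ℝ) :
    HasDerivAt (soliton p M) (-(solitonRate p M * Real.tanh ((p - 2) / 2 * solitonRate p M * x) *
      soliton p M x)) x := by
  have h2 : p - 2 ≠ 0 := by linarith
  set k := (p - 2) / 2 * solitonRate p M with hk
  have hc : Real.cosh (k * x) ≠ 0 := (Real.cosh_pos _).ne'
  have h1 : HasDerivAt (fun y => Real.cosh (k * y)) (Real.sinh (k * x) * (k * 1)) x :=
    ((hasDerivAt_id x).const_mul k).cosh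
  have h3 := (h1.rpow_const (p := -(2 / (p - 2))) (Or.inl hc)).const_mul M
  unfold soliton
  rw [← hk]
  convert! h3 using 1
  rw [Real.rpow_sub_one hc, Real.tanh_eq_sinh_div_cosh]
  have : solitonRate p M = 2 / (p - 2) * k := by rw [hk]; field_simp
  rw [this]
  field_simp

theorem soliton_antitoneOn {p M : ℝ} (hp : 2 < p) (hM : 0 < M) :
    AntitoneOn (soliton p M) (Ici 0) := by
  intro x hx y hy hxy
  have h2 : 0 < p - 2 := by linarith
  have hr := solitonRate_pos hp hM
  refine mul_le_mul_of_nonneg_left (Real.rpow_le_rpow_of_nonpos (Real.cosh_pos _) ?_ ?_) hM.le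
  · rw [Real.cosh_le_cosh, abs_of_nonneg (mul_nonneg (by positivity) hx),
      abs_of_nonneg (mul_nonneg (by positivity) hy)]
    gcongr
  · rw [neg_nonpos]; positivity

/-- The soliton solves `φ' = -solitonSlope p M φ` for `x ≥ 0`, because `M ^ (p - 2) - φ ^ (p - 2) =
M ^ (p - 2) * tanh²`. It thus attains equality in the Young step. -/
theorem solitonSlope_soliton {p M x : ℝ} (hp : 2 < p) (hM : 0 < M) (hx : 0 ≤ x) :
    solitonSlope p M (soliton p M x) =
      solitonRate p M * Real.tanh ((p - 2) / 2 * solitonRate p M * x) * soliton p M x := by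
  have h2 : 0 < p - 2 := by linarith
  have hr := solitonRate_pos hp hM
  set y := (p - 2) / 2 * solitonRate p M * x with hy
  have hy0 : 0 ≤ y := by positivity
  have hcp := Real.cosh_pos y
  have h1 : soliton p M x ^ (p - 2) = M ^ (p - 2) * (Real.cosh y ^ 2)⁻¹ := by
    unfold soliton
    rw [← hy, Real.mul_rpow hM.le (by positivity), ← Real.rpow_mul hcp.le,
      show -(2 / (p - 2)) * (p - 2) = -2 by field_simp, Real.rpow_neg hcp.le, Real.rpow_two]
  have h3 : 2 / p * (M ^ (p - 2) - soliton p M x ^ (p - 2)) =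
      (solitonRate p M * Real.tanh y) ^ 2 := by
    rw [h1, mul_pow, solitonRate_sq hp hM, Real.tanh_eq_sinh_div_cosh, div_pow, Real.sinh_sq]
    field_simp
  have ht : 0 ≤ Real.tanh y := by
    rw [Real.tanh_eq_sinh_div_cosh]
    exact div_nonneg (Real.sinh_nonneg_iff.2 hy0) hcp.le
  unfold solitonSlope
  rw [abs_of_pos (soliton_pos hM x), h3, Real.sqrt_sq (by positivity)]
  ring

/-- From `cosh y ≥ exp y / 2`; this makes the error of cutting the soliton exponentially small. -/
theorem soliton_le_exp {p M x : ℝ} (hp : 2 < p) (hM : 0 < M) :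
    soliton p M x ≤ M * (2 ^ (2 / (p - 2)) * Real.exp (-(solitonRate p M * x))) := by
  have h2 : 0 < p - 2 := by linarith
  refine mul_le_mul_of_nonneg_left ?_ hM.le
  set y := (p - 2) / 2 * solitonRate p M * x with hy
  have h1 : Real.exp y / 2 ≤ Real.cosh y := by
    rw [Real.cosh_eq]; linarith [Real.exp_pos (-y)]
  have h3 := Real.rpow_le_rpow_of_nonpos (z := -(2 / (p - 2))) (by positivity) h1
    (by rw [neg_nonpos]; positivity)
  refine h3.trans (le_of_eq ?_)
  rw [Real.div_rpow (Real.exp_pos _).le zero_le_two, ← Real.exp_mul, Real.rpow_neg zero_le_two,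
    div_inv_eq_mul, mul_comm]
  congr 2
  rw [hy]; field_simp

theorem continuous_soliton {p M : ℝ} (hp : 2 < p) : Continuous (soliton p M) :=
  continuous_iff_continuousAt.2 fun x => (hasDerivAt_soliton hp x).continuousAt

/-- Kinetic energy of the soliton on `[0, L]`. -/
theorem integral_solitonSlope_sq {p M L : ℝ} (hp : 2 < p) (hM : 0 < M) (hL : 0 ≤ L) :
    ∫ x in (0 : ℝ)..L, solitonSlope p M (soliton p M x) ^ 2 =
      slopePrimitive p M M - slopePrimitive p M (soliton p M L) := by
  have hd : ∀ x ∈ uIcc 0 L, HasDerivAt (fun x => -slopePrimitive p M (soliton p M x))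
      (solitonSlope p M (soliton p M x) ^ 2) x := by
    intro x hx
    rw [uIcc_of_le hL] at hx
    have h := ((hasDerivAt_slopePrimitive hp M _).comp x (hasDerivAt_soliton (M := M) hp x)).neg
    convert! h using 1
    rw [← solitonSlope_soliton hp hM hx.1]; ring
  have hc : Continuous fun x => solitonSlope p M (soliton p M x) ^ 2 :=
    ((continuous_solitonSlope hp M).comp (continuous_soliton hp)).pow 2
  rw [intervalIntegral.integral_eq_sub_of_hasDerivAt hd (hc.intervalIntegrable _ _), soliton_zero]
  ring

/-- Mass of the soliton on `[0, L]`. -/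
theorem integral_soliton_sq {p M L : ℝ} (hp : 2 < p) (hM : 0 < M) (hL : 0 ≤ L) :
    (p - 2) / 2 * (2 / p * M ^ (p - 2)) * (∫ x in (0 : ℝ)..L, soliton p M x ^ 2) =
      soliton p M L * solitonSlope p M (soliton p M L) +
        (p + 2) / 2 * (slopePrimitive p M M - slopePrimitive p M (soliton p M L)) := by
  set r := solitonRate p M with hr
  set k := (p - 2) / 2 * r with hk
  -- A virial identity: the function is `-φ * φ'`, and the first integral eliminates `φ ^ p` from
  -- its derivative.
  have hd : ∀ x ∈ uIcc 0 L, HasDerivAt (fun x => r * Real.tanh (k * x) * soliton p M x ^ 2)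
      ((p - 2) / 2 * (2 / p * M ^ (p - 2)) * soliton p M x ^ 2 -
        (p + 2) / 2 * solitonSlope p M (soliton p M x) ^ 2) x := by
    intro x hx
    rw [uIcc_of_le hL] at hx
    have hcp : Real.cosh (k * x) ≠ 0 := (Real.cosh_pos _).ne'
    have h1 : HasDerivAt (fun y => Real.cosh (k * y)) (Real.sinh (k * x) * (k * 1)) x :=
      ((hasDerivAt_id x).const_mul k).cosh
    have h2 : HasDerivAt (fun y => Real.sinh (k * y)) (Real.cosh (k * x) * (k * 1)) x :=
      ((hasDerivAt_id x).const_mul k).sinh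
    have ht : HasDerivAt (fun y => Real.tanh (k * y)) (k * (1 - Real.tanh (k * x) ^ 2)) x := by
      simp only [Real.tanh_eq_sinh_div_cosh]
      convert! h2.div h1 hcp using 1
      field_simp
    have h := (ht.const_mul r).mul ((hasDerivAt_soliton (M := M) hp x).pow 2)
    convert! h using 1
    rw [solitonSlope_soliton hp hM hx.1, ← solitonRate_sq hp hM, ← hr, ← hk]
    simp only [Nat.cast_ofNat, Nat.add_one_sub_one, pow_one, Pi.pow_apply]
    rw [hk]
    ring
  have hc1 : Continuous fun x => soliton p M x ^ 2 := (continuous_soliton hp).pow 2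
  have hc2 : Continuous fun x => solitonSlope p M (soliton p M x) ^ 2 :=
    ((continuous_solitonSlope hp M).comp (continuous_soliton hp)).pow 2
  have h := intervalIntegral.integral_eq_sub_of_hasDerivAt hd
    (((hc1.const_mul _).sub (hc2.const_mul _)).intervalIntegrable _ _)
  rw [intervalIntegral.integral_sub ((hc1.const_mul _).intervalIntegrable _ _)
    ((hc2.const_mul _).intervalIntegrable _ _), intervalIntegral.integral_const_mul,
    intervalIntegral.integral_const_mul, integral_solitonSlope_sq hp hM hL] at h
  rw [solitonSlope_soliton hp hM hL, ← hr, ← hk]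
  simp only [mul_zero, Real.tanh_zero, zero_mul, sub_zero] at h
  linarith

/-- The mass on `[0, L]` is at most half of the mass of the whole soliton. -/
theorem two_mul_integral_soliton_sq_le {p m L : ℝ} (hp : 2 < p) (hp' : p < 6) (hm : 0 < m)
    (hL : 0 ≤ L) :
    2 * ∫ x in (0 : ℝ)..L, soliton p (solitonHeight p m) x ^ 2 ≤ m := by
  set M := solitonHeight p m with hMdef
  have hM : 0 < M := solitonHeight_pos hp hm
  have h2 : 0 < p - 2 := by linarith
  have hspec := solitonHeight_spec hp hp' hm
  rw [← hMdef, ← slopePrimitive_self hM] at hspec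
  have h := integral_soliton_sq hp hM hL
  have hδ := (soliton_pos (p := p) hM L).le
  have h3 := mul_solitonSlope_le (M := M) hp hδ
  have h4 := slopePrimitive_nonneg p M hδ
  have hpos : 0 < (p - 2) / 2 * (2 / p * M ^ (p - 2)) := by positivity
  refine le_of_mul_le_mul_left ?_ hpos
  have h5 : (p - 2) / 2 * (2 / p * M ^ (p - 2)) * m = (p + 2) * slopePrimitive p M M := by
    rw [hspec]; field_simp
  rw [h5]
  -- What remains is `2 * δ * solitonSlope(δ) ≤ (p + 2) * slopePrimitive(δ)`, with `δ` the value at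
  -- `L`; it follows from `h3` and `p > 2`.
  nlinarith

/-- Energy of the soliton lowered by its value at `L`, on `[0, L]`. -/
theorem soliton_energy_le {p m L : ℝ} (hp : 2 < p) (hp' : p < 6) (hm : 0 < m) (hL : 0 ≤ L) :
    (∫ x in (0 : ℝ)..L, solitonSlope p (solitonHeight p m) (soliton p (solitonHeight p m) x) ^ 2)
      - 2 / p * (∫ x in (0 : ℝ)..L,
          (soliton p (solitonHeight p m) x - soliton p (solitonHeight p m) L) ^ p) ≤
      lineEnergy p m + (6 - p) / (p - 2) *
        (solitonRate p (solitonHeight p m) * (soliton p (solitonHeight p m) L ^ 2 / 2)) +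
      2 * L * (soliton p (solitonHeight p m) L * solitonHeight p m ^ (p - 1)) := by
  set M := solitonHeight p m with hMdef
  have hM : 0 < M := solitonHeight_pos hp hm
  set δ := soliton p M L with hδdef
  have h2 : 0 < p - 2 := by linarith
  have h6 : 0 < 6 - p := by linarith
  have hδ : 0 < δ := soliton_pos hM L
  have hcs := continuous_soliton (M := M) hp
  have hle := lineEnergy_eq hp hp' hm
  rw [← hMdef, mul_assoc, ← slopePrimitive_self hM] at hle
  have hmass := integral_soliton_sq hp hM hL
  have hkin := integral_solitonSlope_sq hp hM hL
  rw [← hδdef] at hmass hkin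
  have hΦδ : slopePrimitive p M δ ≤ solitonRate p M * (δ ^ 2 / 2) := slopePrimitive_le hp hδ.le
  have hδW : 0 ≤ δ * solitonSlope p M δ := mul_nonneg hδ.le (solitonSlope_nonneg _ _ _)
  have c2 : Continuous fun x => M ^ (p - 2) * soliton p M x ^ 2 := (hcs.pow 2).const_mul _
  have cp : Continuous fun x => soliton p M x ^ p :=
    hcs.rpow_const fun _ => Or.inr (by linarith)
  have cq : Continuous fun x => (soliton p M x - δ) ^ p :=
    (hcs.sub continuous_const).rpow_const fun _ => Or.inr (by linarith)
  have hk2 : ∫ x in (0 : ℝ)..L, solitonSlope p M (soliton p M x) ^ 2 =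
      2 / p * (M ^ (p - 2) * (∫ x in (0 : ℝ)..L, soliton p M x ^ 2) -
        ∫ x in (0 : ℝ)..L, soliton p M x ^ p) := by
    rw [← intervalIntegral.integral_const_mul, ← intervalIntegral.integral_sub
      (c2.intervalIntegrable _ _) (cp.intervalIntegrable _ _),
      ← intervalIntegral.integral_const_mul]
    refine intervalIntegral.integral_congr fun x _ => ?_
    have hx := soliton_pos (p := p) hM x
    rw [solitonSlope_sq hp (by rw [abs_of_pos hx]; exact soliton_le hp hM x), abs_of_pos hx]
  -- Bernoulli's inequality for `(1 - δ / φ) ^ p`: lowering by `δ` costs at most `p * δ * M ^ (p -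
  -- 1)` per unit length.
  have hlow : (∫ x in (0 : ℝ)..L, soliton p M x ^ p) - L * (p * δ * M ^ (p - 1)) ≤
      ∫ x in (0 : ℝ)..L, (soliton p M x - δ) ^ p := by
    have h := intervalIntegral.integral_mono_on (μ := volume) hL
      (f := fun x => soliton p M x ^ p - p * δ * M ^ (p - 1)) (g := fun x => (soliton p M x - δ) ^ p)
      ((cp.sub continuous_const).intervalIntegrable _ _) (cq.intervalIntegrable _ _) fun x hx => ?_
    · rw [intervalIntegral.integral_sub (cp.intervalIntegrable _ _) (by simp),
        intervalIntegral.integral_const, smul_eq_mul, sub_zero] at h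
      exact h
    · have hsx := soliton_pos (p := p) hM x
      have hδx : δ ≤ soliton p M x := soliton_antitoneOn hp hM hx.1 hL hx.2
      have hb := one_add_mul_self_le_rpow_one_add (s := -(δ / soliton p M x)) (p := p)
        (by rw [neg_le_neg_iff, div_le_one hsx]; exact hδx) (by linarith)
      have e1 : soliton p M x - δ = soliton p M x * (1 + -(δ / soliton p M x)) := by
        field_simp; ring
      have e2 : 0 ≤ 1 + -(δ / soliton p M x) := by
        have : δ / soliton p M x ≤ 1 := (div_le_one hsx).2 hδx
        linarith
      have e3 : soliton p M x ^ p * (1 + p * -(δ / soliton p M x)) =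
          soliton p M x ^ p - p * δ * soliton p M x ^ (p - 1) := by
        rw [Real.rpow_sub_one hsx.ne']; field_simp; ring
      have e4 : soliton p M x ^ (p - 1) ≤ M ^ (p - 1) :=
        Real.rpow_le_rpow hsx.le (soliton_le hp hM x) (by linarith)
      have e5 := mul_le_mul_of_nonneg_left e4 (show 0 ≤ p * δ by positivity)
      rw [e1, Real.mul_rpow hsx.le e2]
      have e6 := mul_le_mul_of_nonneg_left hb (show 0 ≤ soliton p M x ^ p by positivity)
      rw [e3] at e6
      linarith
  have hlow' := mul_le_mul_of_nonneg_left hlow (show 0 ≤ 2 / p by positivity)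
  have e7 : 2 / p * ((∫ x in (0 : ℝ)..L, soliton p M x ^ p) - L * (p * δ * M ^ (p - 1))) =
      2 / p * (∫ x in (0 : ℝ)..L, soliton p M x ^ p) - 2 * L * (δ * M ^ (p - 1)) := by
    field_simp
  rw [e7] at hlow'
  set P := slopePrimitive p M M
  set Q := slopePrimitive p M δ
  -- The kinetic integral is `P - Q`. Eliminating potential and mass leaves `-(6 - p) / (p - 2) * (P
  -- - Q)` minus a nonnegative term: the `P` part is `lineEnergy` and the `Q` part is the error.
  have hmass' : 2 / p * M ^ (p - 2) * (∫ x in (0 : ℝ)..L, soliton p M x ^ 2) =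
      2 / (p - 2) * (δ * solitonSlope p M δ + (p + 2) / 2 * (P - Q)) := by
    rw [← hmass]; field_simp
  have h8 : 0 ≤ 2 / (p - 2) * (δ * solitonSlope p M δ) := by positivity
  have h9 : (6 - p) / (p - 2) * Q ≤ (6 - p) / (p - 2) * (solitonRate p M * (δ ^ 2 / 2)) :=
    mul_le_mul_of_nonneg_left hΦδ (by positivity)
  have h10 : 2 / (p - 2) * ((p + 2) / 2 * (P - Q)) = 2 * (P - Q) + (6 - p) / (p - 2) * (P - Q) := by
    field_simp; ring
  rw [mul_add, h10] at hmass'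
  rw [mul_sub, ← mul_assoc, hmass'] at hk2
  rw [hle]
  linarith

end MetricGraph

namespace MetricGraph
open Filter Topology
open scoped NNReal

/-! ### Functions supported near a vertex -/

variable {V B H : Type*}

theorem memLp_Ioi_of_bound {f : ℝ → ℝ} {C L : ℝ} (hf : AEStronglyMeasurable f)
    (hC : ∀ x ∈ Icc 0 L, |f x| ≤ C) (h0 : ∀ x, L < x → f x = 0) :
    MemLp f 2 (volume.restrict (Ioi 0)) := by
  have h1 : MemLp f 2 (volume.restrict (Ioc 0 L)) := by
    refine MemLp.of_bound hf.restrict C ?_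
    filter_upwards [ae_restrict_mem measurableSet_Ioc] with x hx
    exact hC x (Ioc_subset_Icc_self hx)
  have h2 := ((memLp_indicator_iff_restrict measurableSet_Ioc).2 h1).restrict (Ioi 0)
  refine (memLp_congr_ae ?_).2 h2
  filter_upwards [ae_restrict_mem measurableSet_Ioi] with x hx
  by_cases hxL : x ≤ L
  · rw [indicator_of_mem (show x ∈ Ioc 0 L from ⟨hx, hxL⟩)]
  · rw [indicator_of_notMem (fun h => hxL h.2), h0 x (not_le.1 hxL)]

theorem abs_deriv_le_of_lipschitz {f : ℝ → ℝ} {K : ℝ≥0} (hf : LipschitzWith K f) (x : ℝ) :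
    |deriv f x| ≤ K := norm_deriv_le_of_lipschitz hf

theorem deriv_eq_zero_of_eq_zero {f : ℝ → ℝ} {L x : ℝ} (h0 : ∀ x, L ≤ x → f x = 0) (hx : L < x) :
    deriv f x = 0 := by
  have : f =ᶠ[𝓝 x] fun _ => 0 := by
    filter_upwards [lt_mem_nhds hx] with y hy using h0 y hy.le
  rw [this.deriv_eq, deriv_const]

theorem edgeH1_Ioi_of_lipschitz {f : ℝ → ℝ} {K : ℝ≥0} (hf : LipschitzWith K f) {L : ℝ}
    (h0 : ∀ x, L ≤ x → f x = 0) : EdgeH1 (Ioi 0) f := by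
  obtain ⟨C, hC⟩ := (isCompact_Icc (a := (0 : ℝ)) (b := L)).exists_bound_of_continuousOn
    hf.continuous.continuousOn
  exact ⟨fun T _ _ => (hf.lipschitzOnWith (s := uIcc 0 T)).absolutelyContinuousOnInterval,
    memLp_Ioi_of_bound hf.continuous.aestronglyMeasurable hC fun x hx => h0 x hx.le,
    memLp_Ioi_of_bound (measurable_deriv f).aestronglyMeasurable
      (fun x _ => abs_deriv_le_of_lipschitz hf x) fun x hx => deriv_eq_zero_of_eq_zero h0 hx⟩

theorem edgeH1_Ioo_of_lipschitz {f : ℝ → ℝ} {K : ℝ≥0} (hf : LipschitzWith K f) (l : ℝ) :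
    EdgeH1 (Ioo 0 l) f := by
  obtain ⟨C, hC⟩ := (isCompact_Icc (a := (0 : ℝ)) (b := l)).exists_bound_of_continuousOn
    hf.continuous.continuousOn
  refine ⟨fun T _ _ => (hf.lipschitzOnWith (s := uIcc 0 T)).absolutelyContinuousOnInterval,
    MemLp.of_bound hf.continuous.aestronglyMeasurable C ?_,
    MemLp.of_bound (measurable_deriv f).aestronglyMeasurable K
      (Eventually.of_forall fun x => abs_deriv_le_of_lipschitz hf x)⟩
  filter_upwards [ae_restrict_mem measurableSet_Ioo] with x hx
  exact hC x (Ioo_subset_Icc_self hx)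

/-- The profile sits at the left end with weight `a` and, reflected, at the right end with weight
`b`; `L ≤ l / 2` separates the two. A loop at the vertex has `a = b = 1`. -/
theorem setIntegral_Ioo_of_ends {k g : ℝ → ℝ} {L l a b : ℝ} (hL : 0 ≤ L) (hl : L ≤ l / 2)
    (hk : IntegrableOn k (Ioo 0 L)) (hk0 : ∀ x, L < x → k x = 0)
    (hg1 : ∀ x ∈ Ioo 0 (l / 2), g x = a * k x)
    (hg2 : ∀ x ∈ Ioo (l / 2) l, g x = b * k (l - x)) :
    ∫ x in Ioo 0 l, g x = (a + b) * ∫ x in Ioo 0 L, k x := by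
  have hl0 : 0 ≤ l / 2 := hL.trans hl
  have hl1 : l / 2 ≤ l := by linarith
  have i1 : IntervalIntegrable k volume 0 L := intervalIntegrable_of_Ioo_subset hL hk le_rfl
  have i2 : IntervalIntegrable k volume L (l / 2) := by
    refine (intervalIntegrable_const (c := (0 : ℝ))).congr fun x hx => ?_
    rw [uIoc_of_le hl] at hx
    exact (hk0 x hx.1).symm
  have e2 : ∫ x in L..(l / 2), k x = 0 := by
    rw [intervalIntegral.integral_of_le hl]
    exact setIntegral_eq_zero_of_forall_eq_zero fun x hx => hk0 x hx.1
  have i3 := i1.trans i2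
  have e3 : ∫ x in (0 : ℝ)..(l / 2), k x = ∫ x in Ioo 0 L, k x := by
    rw [← intervalIntegral.integral_add_adjacent_intervals i1 i2, e2, add_zero,
      intervalIntegral.integral_of_le hL, integral_Ioc_eq_integral_Ioo]
  have i4 : IntervalIntegrable (fun x => k (l - x)) volume (l / 2) l := by
    have := (i3.comp_sub_left l).symm
    rwa [sub_zero, show l - l / 2 = l / 2 by ring] at this
  have e4 : ∫ x in (l / 2)..l, k (l - x) = ∫ x in Ioo 0 L, k x := by
    rw [intervalIntegral.integral_comp_sub_left (fun x => k x) l, sub_self,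
      show l - l / 2 = l / 2 by ring, e3]
  have g1 : IntervalIntegrable g volume 0 (l / 2) ∧
      ∫ x in (0 : ℝ)..(l / 2), g x = a * ∫ x in Ioo 0 L, k x := by
    constructor
    · rw [intervalIntegrable_iff_integrableOn_Ioo_of_le hl0]
      have := (i3.const_mul a)
      rw [intervalIntegrable_iff_integrableOn_Ioo_of_le hl0] at this
      exact this.congr_fun (fun x hx => (hg1 x hx).symm) measurableSet_Ioo
    · rw [← e3, ← intervalIntegral.integral_const_mul, intervalIntegral.integral_of_le hl0,
        intervalIntegral.integral_of_le hl0, integral_Ioc_eq_integral_Ioo,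
        integral_Ioc_eq_integral_Ioo]
      exact setIntegral_congr_fun measurableSet_Ioo hg1
  have g2 : IntervalIntegrable g volume (l / 2) l ∧
      ∫ x in (l / 2)..l, g x = b * ∫ x in Ioo 0 L, k x := by
    constructor
    · rw [intervalIntegrable_iff_integrableOn_Ioo_of_le hl1]
      have := (i4.const_mul b)
      rw [intervalIntegrable_iff_integrableOn_Ioo_of_le hl1] at this
      exact this.congr_fun (fun x hx => (hg2 x hx).symm) measurableSet_Ioo
    · rw [← e4, ← intervalIntegral.integral_const_mul, intervalIntegral.integral_of_le hl1,
        intervalIntegral.integral_of_le hl1, integral_Ioc_eq_integral_Ioo,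
        integral_Ioc_eq_integral_Ioo]
      exact setIntegral_congr_fun measurableSet_Ioo hg2
  rw [← integral_Ioc_eq_integral_Ioo, ← intervalIntegral.integral_of_le (hl0.trans hl1),
    ← intervalIntegral.integral_add_adjacent_intervals g1.1 g2.1, g1.2, g2.2]
  ring

theorem setIntegral_Ioi_of_eq_zero {k : ℝ → ℝ} {L : ℝ} (hk0 : ∀ x, L < x → k x = 0) :
    ∫ x in Ioi 0, k x = ∫ x in Ioo 0 L, k x := by
  rw [← integral_Ioc_eq_integral_Ioo]
  refine setIntegral_eq_of_subset_of_forall_sdiff_eq_zero measurableSet_Ioi Ioc_subset_Ioi_self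
    fun x hx => hk0 x ?_
  by_contra h
  exact hx.2 ⟨hx.1, not_lt.1 h⟩

open scoped Classical in
/-- The function that equals `ψ (dist v x)` near the vertex `v` and vanishes far from it. -/
noncomputable def starFun (G : MetricGraph V B H) (v : V) (ψ : ℝ → ℝ) : GraphFun V B H where
  onVertex w := (if w = v then 1 else 0) * ψ 0
  onEdge e x := (if G.src e = v then 1 else 0) * ψ x +
    (if G.tgt e = v then 1 else 0) * ψ (G.length e - x)
  onHalf h x := (if G.base h = v then 1 else 0) * ψ x

open scoped Classical in
theorem natCast_degree [Fintype B] [Fintype H] (G : MetricGraph V B H) (v : V) :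
    (G.degree v : ℝ) = (∑ e, ((if G.src e = v then (1 : ℝ) else 0) + if G.tgt e = v then 1 else 0)) +
      ∑ h, if G.base h = v then 1 else 0 := by
  simp only [degree, Finset.sum_add_distrib, Finset.sum_boole, Set.ncard_eq_toFinset_card']
  push_cast
  simp

/-- A profile for functions supported near a vertex: Lipschitz, and zero at distance at
least `L`. -/
structure IsProfile (G : MetricGraph V B H) (L : ℝ) (ψ : ℝ → ℝ) : Prop where
  lipschitz : ∃ K, LipschitzWith K ψ
  eq_zero : ∀ x, L ≤ x → ψ x = 0
  pos : 0 < L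
  le_length : ∀ e, L ≤ G.length e / 2

theorem IsProfile.memH1 {G : MetricGraph V B H} {L : ℝ} {ψ : ℝ → ℝ} (h : G.IsProfile L ψ) (v : V) :
    G.MemH1 (G.starFun v ψ) := by
  obtain ⟨K, hK⟩ := h.lipschitz
  have hl : ∀ e, L ≤ G.length e := fun e => by
    have := h.le_length e; have := h.pos; linarith
  have hmul : ∀ (c : ℝ) {K' : ℝ≥0} {f : ℝ → ℝ}, LipschitzWith K' f →
      LipschitzWith (‖c‖₊ * K') fun x => c * f x := fun c _ _ hf => (lipschitzWith_smul c).comp hf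
  refine .of_edgeH1 (fun i => ?_) (fun e => ?_) (fun e => ?_) fun h => rfl
  · cases i with
    | inl e =>
      have hK' : LipschitzWith (K * (0 + 1)) fun x => ψ (G.length e - x) :=
        hK.comp ((LipschitzWith.const _).sub LipschitzWith.id)
      exact edgeH1_Ioo_of_lipschitz ((hmul _ hK).add (hmul _ hK')) _
    | inr e =>
      exact edgeH1_Ioi_of_lipschitz (hmul _ hK) (L := L) fun x hx => by
        simp only [GraphFun.onArc, starFun, Sum.elim_inr, h.eq_zero x hx, mul_zero]
  · simp [starFun, h.eq_zero _ (hl e)]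
  · simp [starFun, h.eq_zero _ (hl e)]

/-- Each edge end at `v` contributes one copy of the integral over `(0, L)`, and the degree counts
the ends. The operation `T` covers both `F ∘ f` and `(f')²`: all that matters is that it is local,
kills the zero function and respects reflection. -/
theorem IsProfile.sum_eq [Fintype B] [Fintype H] {G : MetricGraph V B H} {L : ℝ} {ψ : ℝ → ℝ}
    (h : G.IsProfile L ψ) (v : V) {k : ℝ → ℝ} (hk : IntegrableOn k (Ioo 0 L))
    (hk0 : ∀ x, L < x → k x = 0) (T : (ℝ → ℝ) → ℝ → ℝ)
    (hT : ∀ f g : ℝ → ℝ, ∀ x, f =ᶠ[𝓝 x] g → T f x = T g x)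
    (hT0 : ∀ x, T (fun _ => 0) x = 0) (hTψ : ∀ x, 0 < x → T ψ x = k x)
    (hTsub : ∀ l x, T (fun y => ψ (l - y)) x = T ψ (l - x)) :
    ∑ i, ∫ x in G.arcDomain i, T ((G.starFun v ψ).onArc i) x =
      G.degree v * ∫ x in Ioo 0 L, k x := by
  classical
  rw [natCast_degree, Fintype.sum_sum_type, add_mul, Finset.sum_mul, Finset.sum_mul]
  congr 1
  · refine Finset.sum_congr rfl fun e _ => ?_
    have hle := h.le_length e
    have hTe : ∀ (c : Prop) [Decidable c] (f : ℝ → ℝ) (x : ℝ),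
        T (fun y => (if c then 1 else 0) * f y) x = (if c then 1 else 0) * T f x := by
      intro c _ f x
      split_ifs
      · simp only [one_mul]
      · simp only [zero_mul, hT0]
    refine setIntegral_Ioo_of_ends h.pos.le hle hk hk0 (fun x hx => ?_) (fun x hx => ?_)
    · rw [← hTψ x hx.1, ← hTe]
      refine hT _ _ _ ?_
      filter_upwards [gt_mem_nhds hx.2] with y hy
      simp [GraphFun.onArc, starFun, h.eq_zero (G.length e - y) (by linarith)]
    · rw [← hTψ _ (sub_pos.2 hx.2), ← hTsub, ← hTe]
      refine hT _ _ _ ?_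
      filter_upwards [lt_mem_nhds hx.1] with y hy
      simp [GraphFun.onArc, starFun, h.eq_zero y (by linarith)]
  · refine Finset.sum_congr rfl fun e _ => ?_
    rw [← setIntegral_Ioi_of_eq_zero hk0, ← integral_const_mul]
    refine setIntegral_congr_fun measurableSet_Ioi fun x hx => ?_
    simp only [GraphFun.onArc, starFun, Sum.elim_inr]
    rw [← hTψ x hx]
    split_ifs
    · simp only [one_mul]
    · simp only [zero_mul, hT0]

theorem IsProfile.sum_comp_eq [Fintype B] [Fintype H] {G : MetricGraph V B H} {L : ℝ} {ψ : ℝ → ℝ}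
    (h : G.IsProfile L ψ) (v : V) {F : ℝ → ℝ} (hF : Continuous F) (hF0 : F 0 = 0) :
    ∑ i, ∫ x in G.arcDomain i, F ((G.starFun v ψ).onArc i x) =
      G.degree v * ∫ x in Ioo 0 L, F (ψ x) := by
  obtain ⟨K, hK⟩ := h.lipschitz
  refine h.sum_eq v (k := fun x => F (ψ x)) ?_ (fun x hx => by rw [h.eq_zero x hx.le, hF0])
    (fun f x => F (f x)) (fun f g x hfg => by simp only [hfg.self_of_nhds]) (fun _ => hF0)
    (fun _ _ => rfl) fun _ _ => rfl
  exact ((hF.comp hK.continuous).integrableOn_Icc (a := 0) (b := L)).mono_set Ioo_subset_Icc_self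

theorem IsProfile.kinetic_starFun [Fintype B] [Fintype H] {G : MetricGraph V B H} {L : ℝ}
    {ψ : ℝ → ℝ} (h : G.IsProfile L ψ) (v : V) :
    G.kinetic (G.starFun v ψ) = G.degree v * ∫ x in Ioo 0 L, deriv ψ x ^ 2 := by
  obtain ⟨K, hK⟩ := h.lipschitz
  refine h.sum_eq v (k := fun x => deriv ψ x ^ 2) ?_
    (fun x hx => by rw [deriv_eq_zero_of_eq_zero h.eq_zero hx]; norm_num)
    (fun f x => deriv f x ^ 2) (fun f g x hfg => by simp only [hfg.deriv_eq]) (fun _ => by simp)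
    (fun _ _ => rfl) fun l x => ?_
  · exact ((edgeH1_Ioo_of_lipschitz hK L).deriv_memLp).integrable_sq
  · simp only [deriv_comp_const_sub, neg_sq]

theorem IsProfile.mass_starFun [Fintype B] [Fintype H] {G : MetricGraph V B H} {L : ℝ}
    {ψ : ℝ → ℝ} (h : G.IsProfile L ψ) (v : V) :
    G.mass (G.starFun v ψ) = G.degree v * ∫ x in Ioo 0 L, ψ x ^ 2 := by
  rw [mass_eq]
  exact h.sum_comp_eq v (F := fun s => s ^ 2) (by fun_prop) (by norm_num)

theorem IsProfile.energy_starFun [Fintype V] [Fintype B] [Fintype H] {G : MetricGraph V B H}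
    {L p q : ℝ} {ψ : ℝ → ℝ} (h : G.IsProfile L ψ) (v : V) (hp : 0 < p) (hq : 0 < q) :
    G.energy p q (G.starFun v ψ) = G.degree v * (1 / 2 * (∫ x in Ioo 0 L, deriv ψ x ^ 2) -
      1 / p * ∫ x in Ioo 0 L, |ψ x| ^ p) - 1 / q * |ψ 0| ^ q := by
  have h1 : G.potential p (G.starFun v ψ) = G.degree v * ∫ x in Ioo 0 L, |ψ x| ^ p :=
    h.sum_comp_eq v (F := fun s => |s| ^ p)
      ((Real.continuous_rpow_const hp.le).comp continuous_abs) (by simp [hp.ne'])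
  have h2 : ∑ w, |(G.starFun v ψ).onVertex w| ^ q = |ψ 0| ^ q := by
    classical
    rw [Finset.sum_eq_single v]
    · simp [starFun]
    · intro w _ hw; simp [starFun, hw, hq.ne']
    · simp
  rw [energy_eq, h.kinetic_starFun, h1, h2]
  ring

/-! ### Large masses -/

/-- The soliton lowered by its value at `L` and cut off at `L`. -/
noncomputable def cutSoliton (p M L x : ℝ) : ℝ := max (soliton p M x - soliton p M L) 0

theorem exists_lipschitzWith_cutSoliton {p M : ℝ} (hp : 2 < p) (hM : 0 < M) (L : ℝ) :
    ∃ K, LipschitzWith K (cutSoliton p M L) := by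
  have hr := solitonRate_pos hp hM
  have hs : LipschitzWith (Real.toNNReal (solitonRate p M * M)) (soliton p M) := by
    refine lipschitzWith_of_nnnorm_deriv_le (fun x => (hasDerivAt_soliton hp x).differentiableAt)
      fun x => ?_
    rw [← NNReal.coe_le_coe, coe_nnnorm, Real.coe_toNNReal _ (by positivity),
      (hasDerivAt_soliton hp x).deriv, Real.norm_eq_abs, abs_neg, abs_mul, abs_mul,
      abs_of_pos hr, abs_of_pos (soliton_pos hM x), mul_assoc]
    refine mul_le_mul_of_nonneg_left ?_ hr.le
    have h1 : |Real.tanh ((p - 2) / 2 * solitonRate p M * x)| ≤ 1 := (Real.abs_tanh_lt_one _).le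
    calc _ ≤ 1 * soliton p M x := mul_le_mul_of_nonneg_right h1 (soliton_pos hM x).le
      _ ≤ M := by rw [one_mul]; exact soliton_le hp hM x
  exact ⟨_, (hs.sub (LipschitzWith.const (soliton p M L))).max_const 0⟩

theorem cutSoliton_of_le {p M L x : ℝ} (hp : 2 < p) (hM : 0 < M) (hx : 0 ≤ x) (hxL : x ≤ L) :
    cutSoliton p M L x = soliton p M x - soliton p M L :=
  max_eq_left (sub_nonneg.2 (soliton_antitoneOn hp hM hx (hx.trans hxL) hxL))

theorem cutSoliton_of_ge {p M L x : ℝ} (hp : 2 < p) (hM : 0 < M) (hL : 0 ≤ L) (hxL : L ≤ x) :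
    cutSoliton p M L x = 0 :=
  max_eq_right (sub_nonpos.2 (soliton_antitoneOn hp hM hL (hL.trans hxL) hxL))

theorem deriv_cutSoliton {p M L x : ℝ} (hp : 2 < p) (hM : 0 < M) (hx : x ∈ Ioo 0 L) :
    deriv (cutSoliton p M L) x = -solitonSlope p M (soliton p M x) := by
  have : cutSoliton p M L =ᶠ[𝓝 x] fun y => soliton p M y - soliton p M L := by
    filter_upwards [isOpen_Ioo.mem_nhds hx] with y hy
    exact cutSoliton_of_le hp hM hy.1.le hy.2.le
  rw [this.deriv_eq, deriv_sub_const, (hasDerivAt_soliton hp x).deriv,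
    solitonSlope_soliton hp hM hx.1.le]

theorem tendsto_solitonHeight {p : ℝ} (hp : 2 < p) (hp' : p < 6) :
    Tendsto (solitonHeight p) atTop atTop := by
  have hJ := lineConst_pos hp
  have h2 : 0 < p - 2 := by linarith
  have h6 : 0 < 6 - p := by linarith
  refine (tendsto_rpow_atTop (by positivity)).comp ?_
  exact (tendsto_id.const_mul_atTop h2).atTop_div_const (by positivity)

/-- At a fixed distance `L` the soliton is at most a constant times `M * exp (-b * M ^ s)`, which
beats every power of `M`. -/
theorem tendsto_soliton_mul_rpow {p L : ℝ} (hp : 2 < p) (hL : 0 < L) :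
    Tendsto (fun M => soliton p M L * M ^ (p - 1)) atTop (𝓝 0) := by
  have h2 : 0 < p - 2 := by linarith
  set s := (p - 2) / 2 with hs
  have hs0 : 0 < s := by positivity
  set b := √(2 / p) * L with hb
  have hb0 : 0 < b := by positivity
  have h := ((tendsto_rpow_mul_exp_neg_mul_atTop_nhds_zero (p / s) b hb0).comp
    (tendsto_rpow_atTop hs0)).const_mul (2 ^ (2 / (p - 2)))
  rw [mul_zero] at h
  refine squeeze_zero' ?_ ?_ h
  · filter_upwards [eventually_gt_atTop 0] with M hM
    exact mul_nonneg (soliton_pos hM L).le (by positivity)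
  · filter_upwards [eventually_gt_atTop 0] with M hM
    have h1 := mul_le_mul_of_nonneg_right (soliton_le_exp (x := L) hp hM)
      (show 0 ≤ M ^ (p - 1) by positivity)
    refine h1.trans (le_of_eq ?_)
    have e1 : solitonRate p M * L = b * M ^ s := by
      rw [solitonRate, Real.sqrt_mul (by positivity), Real.sqrt_eq_rpow (M ^ (p - 2)),
        ← Real.rpow_mul hM.le, hb, hs]
      ring_nf
    have e2 : (M ^ s) ^ (p / s) = M * M ^ (p - 1) := by
      rw [← Real.rpow_mul hM.le, mul_div_cancel₀ _ hs0.ne', ← Real.rpow_one_add' hM.le (by linarith)]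
      congr 1; ring
    simp only [Function.comp]
    rw [e1, e2, neg_mul]
    ring

/-- Both error terms are bounded by multiples of `δ * M ^ (p - 1) → 0`, with `δ = soliton p M L`,
while the vertex gain is at least `1 / q` once `M - δ ≥ 1`. -/
theorem eventually_soliton_error_lt {p q L : ℝ} (hp : 2 < p) (hp' : p < 6) (hq : 2 < q)
    (hL : 0 < L) :
    ∀ᶠ M in atTop, (6 - p) / (p - 2) * (solitonRate p M * (soliton p M L ^ 2 / 2)) +
      2 * L * (soliton p M L * M ^ (p - 1)) < 1 / q * (M - soliton p M L) ^ q := by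
  have h2 : 0 < p - 2 := by linarith
  have h6 : 0 < 6 - p := by linarith
  set C := (6 - p) / (p - 2) * (√(2 / p) / 2) + 2 * L with hC
  have h := tendsto_soliton_mul_rpow hp hL
  have h' := h.const_mul C
  rw [mul_zero] at h'
  filter_upwards [h.eventually (gt_mem_nhds one_pos),
    h'.eventually (gt_mem_nhds (show 0 < 1 / q by positivity)), eventually_ge_atTop 2]
    with M hM1 hM2 hM
  have hM0 : 0 < M := by linarith
  set δ := soliton p M L with hδ
  have hδ0 : 0 < δ := soliton_pos hM0 L
  set X := δ * M ^ (p - 1) with hX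
  have hXδ : δ ≤ X :=
    le_mul_of_one_le_right hδ0.le (Real.one_le_rpow (by linarith) (by linarith))
  have hrate : solitonRate p M ≤ √(2 / p) * M ^ (p - 1) := by
    rw [solitonRate, Real.sqrt_mul (by positivity), Real.sqrt_eq_rpow (M ^ (p - 2)),
      ← Real.rpow_mul hM0.le]
    exact mul_le_mul_of_nonneg_left (Real.rpow_le_rpow_of_exponent_le (by linarith) (by linarith))
      (by positivity)
  have h3 : solitonRate p M * (δ ^ 2 / 2) ≤ √(2 / p) / 2 * X := by
    calc _ ≤ √(2 / p) * M ^ (p - 1) * (δ ^ 2 / 2) := by gcongr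
      _ = √(2 / p) / 2 * (X * δ) := by rw [hX]; ring
      _ ≤ √(2 / p) / 2 * (X * 1) := by
        have : 0 ≤ X := hδ0.le.trans hXδ
        gcongr
        linarith
      _ = _ := by ring
  have h4 : (6 - p) / (p - 2) * (solitonRate p M * (δ ^ 2 / 2)) ≤
      (6 - p) / (p - 2) * (√(2 / p) / 2 * X) := by gcongr
  have h5 : 1 ≤ (M - δ) ^ q := Real.one_le_rpow (by linarith) (by linarith)
  have h6 : 1 / q ≤ 1 / q * (M - δ) ^ q := le_mul_of_one_le_right (by positivity) h5
  rw [hC] at hM2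
  nlinarith

theorem exists_pos_le_half_length [Finite B] (G : MetricGraph V B H) :
    ∃ L : ℝ, 0 < L ∧ ∀ e, L ≤ G.length e / 2 := by
  rcases isEmpty_or_nonempty B with h | h
  · exact ⟨1, one_pos, fun e => h.elim e⟩
  · obtain ⟨e₀, he₀⟩ := Finite.exists_min G.length
    exact ⟨G.length e₀ / 2, half_pos (G.length_pos e₀), fun e => by linarith [he₀ e]⟩

/-- For large masses there are functions, supported near a vertex of degree two, whose energy is
below the threshold. -/
theorem eventually_exists_energy_lt_of_large [Fintype V] [Fintype B] [Fintype H]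
    (G : MetricGraph V B H) {v : V} (hv : G.degree v = 2) {p q : ℝ} (hp : 2 < p) (hp' : p < 6)
    (hq : 2 < q) :
    ∀ᶠ m : ℝ in atTop, ∃ w : GraphFun V B H, G.MemH1 w ∧ G.mass w ≤ m ∧
      G.energy p q w < lineEnergy p m := by
  obtain ⟨L, hL, hLe⟩ := G.exists_pos_le_half_length
  filter_upwards [(tendsto_solitonHeight hp hp').eventually
    (eventually_soliton_error_lt hp hp' hq hL), eventually_gt_atTop 0] with m herr hm
  set M := solitonHeight p m with hMdef
  have hM : 0 < M := solitonHeight_pos hp hm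
  set ψ := cutSoliton p M L with hψ
  have hprof : G.IsProfile L ψ := ⟨exists_lipschitzWith_cutSoliton hp hM L,
    fun x hx => cutSoliton_of_ge hp hM hL.le hx, hL, hLe⟩
  have hIoo : ∀ f : ℝ → ℝ, ∫ x in Ioo 0 L, f x = ∫ x in (0 : ℝ)..L, f x := fun f => by
    rw [intervalIntegral.integral_of_le hL.le, integral_Ioc_eq_integral_Ioo]
  have hcs := continuous_soliton (M := M) hp
  -- Degree two means two copies of the cut half-soliton: together they have mass at most `m` and
  -- nearly the energy of the soliton, and the vertex term outweighs the cutting error.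
  refine ⟨G.starFun v ψ, hprof.memH1 v, ?_, ?_⟩
  · rw [hprof.mass_starFun, hv]
    refine le_trans ?_ (two_mul_integral_soliton_sq_le hp hp' hm hL.le)
    rw [← hMdef, hIoo]
    push_cast
    refine mul_le_mul_of_nonneg_left ?_ zero_le_two
    obtain ⟨K, hK⟩ := hprof.lipschitz
    refine intervalIntegral.integral_mono_on hL.le ((hK.continuous.pow 2).intervalIntegrable _ _)
      ((hcs.pow 2).intervalIntegrable _ _) fun x hx => ?_
    have h1 := soliton_pos (p := p) hM L
    have h2 := soliton_antitoneOn hp hM hx.1 hL.le hx.2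
    rw [hψ, cutSoliton_of_le hp hM hx.1 hx.2]
    exact pow_le_pow_left₀ (by linarith) (by linarith) 2
  · rw [hprof.energy_starFun v (by linarith) (by linarith), hv]
    have e1 : ∫ x in Ioo 0 L, deriv ψ x ^ 2 =
        ∫ x in (0 : ℝ)..L, solitonSlope p M (soliton p M x) ^ 2 := by
      rw [← hIoo]
      refine setIntegral_congr_fun measurableSet_Ioo fun x hx => ?_
      simp only [hψ, deriv_cutSoliton hp hM hx, neg_sq]
    have e2 : ∫ x in Ioo 0 L, |ψ x| ^ p =
        ∫ x in (0 : ℝ)..L, (soliton p M x - soliton p M L) ^ p := by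
      rw [← hIoo]
      refine setIntegral_congr_fun measurableSet_Ioo fun x hx => ?_
      have h0 : 0 ≤ ψ x := le_max_right _ _
      simp only [abs_of_nonneg h0]
      rw [hψ, cutSoliton_of_le hp hM hx.1.le hx.2.le]
    have e3 : |ψ 0| = M - soliton p M L := by
      rw [abs_of_nonneg (le_max_right _ _), hψ, cutSoliton_of_le hp hM le_rfl hL.le, soliton_zero]
    have h := soliton_energy_le hp hp' hm hL.le
    rw [← hMdef] at h
    rw [e1, e2, e3]
    push_cast
    have e4 : ∀ a b : ℝ, 2 * (1 / 2 * a - 1 / p * b) = a - 2 / p * b := fun a b => by ring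
    rw [e4]
    linarith

end MetricGraph

theorem mainTheorem7 {V B H : Type*} [Fintype V] [Fintype B] [Fintype H]
    (G : MetricGraph V B H) (hconn : G.Connected) (hH : G.AssumptionH)
    (hhalf : 3 ≤ Fintype.card H) (hdeg : ∃ v : V, G.degree v = 2)
    (p q : ℝ) (hp : 2 < p) (hp' : p < 6) (hq : 2 < q) (hq' : q < 4) (hpq : q < p / 2 + 1) :
    ∃ μlow > 0, ∃ μhigh > 0,
      (∀ μ : ℝ, 0 < μ → μ < μlow → ∃ u : GraphFun V B H, G.IsGroundState p q μ u) ∧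
      (∀ μ : ℝ, μhigh ≤ μ → ∃ u : GraphFun V B H, G.IsGroundState p q μ u) := by
  obtain ⟨v, hv⟩ := hdeg
  have : Nonempty V := hconn.1
  have : Nonempty H := Fintype.card_pos_iff.1 (by omega)
  obtain ⟨a, ha, hsmall⟩ := mem_nhdsGT_iff_exists_Ioo_subset.1
    (G.eventually_exists_energy_lt_of_small hp hp' hq hpq)
  obtain ⟨b, hb⟩ := Filter.eventually_atTop.1
    (G.eventually_exists_energy_lt_of_large hv hp hp' hq)
  -- The `1` keeps the upper threshold, and hence every mass above it, positive.
  refine ⟨a, ha, max b 1, by positivity, fun μ h0 hμ => ?_, fun μ hμ => ?_⟩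
  · obtain ⟨w, hw, hwm, hlt⟩ := hsmall ⟨h0, hμ⟩
    exact MetricGraph.exists_isGroundState_of_lt hH hp hp' hq hq' h0 hw hwm hlt
  · obtain ⟨w, hw, hwm, hlt⟩ := hb μ ((le_max_left _ _).trans hμ)
    exact MetricGraph.exists_isGroundState_of_lt hH hp hp' hq hq'
      (one_pos.trans_le ((le_max_right _ _).trans hμ)) hw hwm hlt
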